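/- Fix $\nu>0$, $p\in(0,1)$, let $q=1-p$, and let $\bar\alpha,\bar\beta,\bar\delta,\bar\epsilon,\bar\eta>0$. Consider the following Markov process (the limiting one-particle "two plane" process of the approximate master equation of the evolving voter model). Its configurations are the triples $(i,x,y)$ with $i\in\{0,1\}$ (the plane) and $x,y\ge 0$. While the particle is in plane 1 its coordinates follow $$\frac{dx}{dt}=\bar\eta+p\,y+\nu\bar\alpha\,y-\nu\bar\beta\,x,\qquad \frac{dy}{dt}=\bar\eta-y-p\,y-\nu\bar\alpha\,y+\nu\bar\beta\,x,$$ and while it is in plane 0 they follow $$\frac{dx}{dt}=\bar\eta-x-q\,x-\nu\bar\delta\,x+\nu\bar\epsilon\,y,\qquad \frac{dy}{dt}=\bar\eta+q\,x+\nu\bar\delta\,x-\nu\bar\epsilon\,y.$$ The particle jumps from plane 1 to plane 0 at rate $\nu y$ and from plane 0 to plane 1 at rate $\nu x$, keeping its coordinates $(x,y)$ when it jumps; that is, given its current state, the time to the next jump exceeds $t$ with probability $\exp\left(-\int_0^t r(u)\,du\right)$, where $r(u)$ is the jump rate after it has followed the differential equation of its plane for time $u$. Then this process has a unique stationary distribution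 $\pi$ (a probability measure on the configurations), and for every initial configuration, deterministic or random, the law of the process at time $t$ converges weakly to $\pi$ as $t\to\infty$. -/

import Mathlib

open MeasureTheory ProbabilityTheory Filter
open scoped NNReal Matrix

noncomputable section

/-- The parameters of the limiting two plane system: the voting rate `ν`, the density `p` of ones
and the scaled statistics `α, β, δ, ε, η` (written with bars in the literature). -/
structure TwoPlaneParams where
  ν : ℝ
  p : ℝ
  α : ℝ
  β : ℝ
  δ : ℝ
  ε : ℝ
  η : ℝ

namespace TwoPlane

/-- A state of the particle: the plane it is in (`true` is plane 1, `false` is plane 0) and its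
coordinates `(x, y)`, stored as a vector `z` with `z 0 = x` and `z 1 = y`. -/
abbrev State : Type := Bool × (Fin 2 → ℝ)

/-- The configurations of the particle: points with nonnegative coordinates in one of the
two planes. -/
def configurations : Set State := {s | 0 ≤ s.2 0 ∧ 0 ≤ s.2 1}

/-- The vector fields that the particle follows in the two planes. -/
def drift (P : TwoPlaneParams) : Bool → (Fin 2 → ℝ) → (Fin 2 → ℝ)
  | true, z =>
    ![P.η + P.p * z 1 + P.ν * P.α * z 1 - P.ν * P.β * z 0,
      P.η - z 1 - P.p * z 1 - P.ν * P.α * z 1 + P.ν * P.β * z 0]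
  | false, z =>
    ![P.η - z 0 - (1 - P.p) * z 0 - P.ν * P.δ * z 0 + P.ν * P.ε * z 1,
      P.η + (1 - P.p) * z 0 + P.ν * P.δ * z 0 - P.ν * P.ε * z 1]

/-- The linear parts of the two vector fields. -/
def driftMatrix (P : TwoPlaneParams) : Bool → Matrix (Fin 2) (Fin 2) ℝ
  | true =>
    !![-(P.ν * P.β), P.p + P.ν * P.α;
       P.ν * P.β, -(1 + P.p + P.ν * P.α)]
  | false =>
    !![-(1 + (1 - P.p) + P.ν * P.δ), P.ν * P.ε;
       (1 - P.p) + P.ν * P.δ, -(P.ν * P.ε)]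

/-- The zeros of the two vector fields. -/
def fixedPoint (P : TwoPlaneParams) : Bool → (Fin 2 → ℝ)
  | true => ![P.η * (1 + 2 * P.p + 2 * P.ν * P.α) / (P.ν * P.β), 2 * P.η]
  | false => ![2 * P.η, P.η * (1 + 2 * (1 - P.p) + 2 * P.ν * P.δ) / (P.ν * P.ε)]

/-- `flow P i t z` is the position at time `t` of the solution of the differential equation of
plane `i` started from `z`; see `flow_zero` and `hasDerivAt_flow`. -/
def flow (P : TwoPlaneParams) (i : Bool) (t : ℝ) (z : Fin 2 → ℝ) : Fin 2 → ℝ :=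
  fixedPoint P i + NormedSpace.exp (t • driftMatrix P i) *ᵥ (z - fixedPoint P i)

theorem drift_eq (P : TwoPlaneParams) (hν : 0 < P.ν) (hβ : 0 < P.β) (hε : 0 < P.ε)
    (i : Bool) (z : Fin 2 → ℝ) :
    drift P i z = driftMatrix P i *ᵥ (z - fixedPoint P i) := by
  have h1 := hν.ne'
  have h2 := hβ.ne'
  have h3 := hε.ne'
  cases i <;> funext k <;> fin_cases k <;>
    simp [drift, driftMatrix, fixedPoint, Matrix.mulVec, dotProduct, Fin.sum_univ_two] <;>
    field_simp <;> ring

theorem flow_zero (P : TwoPlaneParams) (i : Bool) (z : Fin 2 → ℝ) : flow P i 0 z = z := by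
  simp [flow]

open scoped Matrix.Norms.Operator in
theorem hasDerivAt_flow (P : TwoPlaneParams) (hν : 0 < P.ν) (hβ : 0 < P.β) (hε : 0 < P.ε)
    (i : Bool) (z : Fin 2 → ℝ) (t : ℝ) :
    HasDerivAt (fun u => flow P i u z) (drift P i (flow P i t z)) t := by
  have h := hasDerivAt_exp_smul_const' (𝕂 := ℝ) (driftMatrix P i) t
  have h' := ((LinearMap.toContinuousLinearMap ((Matrix.mulVecBilin ℝ ℝ).flip
    (z - fixedPoint P i))).hasFDerivAt.comp_hasDerivAt t h).const_add (fixedPoint P i)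
  rw [drift_eq P hν hβ hε]
  unfold flow
  rw [add_sub_cancel_left, Matrix.mulVec_mulVec]
  exact h'

/-- The rate at which the particle jumps to the other plane: `ν y` in plane 1, `ν x` in
plane 0. -/
def rate (P : TwoPlaneParams) : Bool → (Fin 2 → ℝ) → ℝ
  | true, z => P.ν * z 1
  | false, z => P.ν * z 0

/-- The jump rate accumulated up to time `t` by a particle that starts at `s` and does not
change planes. -/
def hazard (P : TwoPlaneParams) (s : State) (t : ℝ) : ℝ :=
  ∫ u in (0 : ℝ)..t, rate P s.1 (flow P s.1 u s.2)

/-- The time at which the particle started at `s` jumps, when its exponential clock has the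
value `e`: the first time at which the accumulated rate reaches `e`. For `e` exponential with
mean one, this time exceeds `t` with probability `exp (-hazard P s t)`. -/
def holdingTime (P : TwoPlaneParams) (s : State) (e : ℝ) : ℝ :=
  sInf {t : ℝ | 0 ≤ t ∧ e ≤ hazard P s t}

/-- The state of the particle right after its `n`-th jump, for the initial state `s` and the
exponential clocks `ω 0, ω 1, …`. -/
def jumpState (P : TwoPlaneParams) (s : State) (ω : ℕ → ℝ) : ℕ → State
  | 0 => s
  | n + 1 =>
    (!(jumpState P s ω n).1,
      flow P (jumpState P s ω n).1 (holdingTime P (jumpState P s ω n) (ω n))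
        (jumpState P s ω n).2)

/-- The time of the `n`-th jump. -/
def jumpTime (P : TwoPlaneParams) (s : State) (ω : ℕ → ℝ) (n : ℕ) : ℝ :=
  ∑ k ∈ Finset.range n, holdingTime P (jumpState P s ω k) (ω k)

/-- The number of jumps up to time `t` (almost surely finite). -/
def jumpCount (P : TwoPlaneParams) (s : State) (ω : ℕ → ℝ) (t : ℝ) : ℕ :=
  sSup {n : ℕ | jumpTime P s ω n ≤ t}

/-- The state at time `t` of the particle that starts at `s`: the last jump state, moved along
the flow of its plane for the time elapsed since that jump. -/
def process (P : TwoPlaneParams) (t : ℝ≥0) (s : State) (ω : ℕ → ℝ) : State :=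
  ((jumpState P s ω (jumpCount P s ω t)).1,
    flow P (jumpState P s ω (jumpCount P s ω t)).1
      ((t : ℝ) - jumpTime P s ω (jumpCount P s ω t))
      (jumpState P s ω (jumpCount P s ω t)).2)

instance isProbabilityMeasure_exp_one : IsProbabilityMeasure (expMeasure 1) :=
  isProbabilityMeasure_expMeasure one_pos

/-- The law of a sequence of independent exponential clocks with mean one. -/
def clocks : Measure (ℕ → ℝ) := Measure.infinitePi fun _ : ℕ => expMeasure 1

instance isProbabilityMeasure_clocks : IsProbabilityMeasure clocks := by
  unfold clocks; infer_instance

/-- `μ` is a probability distribution on the configurations of the particle. -/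
def IsInitialLaw (μ : ProbabilityMeasure State) : Prop :=
  ∀ᵐ s ∂(μ : Measure State), s ∈ configurations

/-- `μ` is stationary: if the initial state has law `μ` and is independent of the clocks, then
the state at every time has law `μ`. -/
def IsStationary (P : TwoPlaneParams) (μ : ProbabilityMeasure State) : Prop :=
  ∀ t : ℝ≥0,
    ((μ : Measure State).prod clocks).map (fun x => process P t x.1 x.2) = (μ : Measure State)

end TwoPlane

end

/-! The particles only have to come close, not to meet. Both drift matrices have nonnegative
off-diagonal entries and column sums 0 and -1 in some order, so the flows do not increase the ℓ¹
norm. Adding a small multiple θ of `|w 0 - w 1|` gives a norm that decreases at a rate c in both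
planes at once (`exists_contracts`, `wnorm_exp_le`). Hence the compact sets `region θ B` with B ≥
2η/c are invariant: rates are bounded there and jumps do not accumulate. The inflow η also keeps the
rates bounded below after one time unit (`exists_rate_flow_ge`), so the particle keeps changing
planes.

For a test function f with oscillation O on a region and Lipschitz constant L within each plane, two
estimates drive the proof.

Regularity (`expect_lipschitz`): let two particles in the same plane jump together whenever
possible. Their jumps fail to match at a rate of at most ν times their distance, which decays like
exp(-ct). So the expectation at time t has Lipschitz constant at most L exp(-ct) + (ν/c) O.

Recurrence (`exists_minorization`): from anywhere in the region, with probability at least κ > 0,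
the particle is at time T in plane 1 and within ε of one reference point. So the oscillation at time
T is at most (1 - κ) O + 2κLε.

For T large, a weighted sum O + wL therefore shrinks by a factor ρ < 1 (`exists_contraction`).
Iterating by the Markov property `expect_add`, expectations become independent of time and starting
point (`expect_asymptotically_constant`). The laws started from the origin of plane 1 are tight; a
cluster point π is then the limit from every configuration, and the Feller property
`continuous_expect` makes it stationary (`exists_limit_law`). Random initial laws, and hence
uniqueness, follow by dominated convergence. -/

noncomputable section

namespace TwoPlane

/-! ### A norm contracted by both flows -/

/-- A weighted norm of the plane for which the flows of both planes are contractions. -/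
def wnorm (θ : ℝ) (w : Fin 2 → ℝ) : ℝ := |w 0| + |w 1| + θ * |w 0 - w 1|

theorem wnorm_nonneg {θ : ℝ} (hθ : 0 ≤ θ) (w : Fin 2 → ℝ) : 0 ≤ wnorm θ w := by
  unfold wnorm; positivity

theorem wnorm_add_le {θ : ℝ} (hθ : 0 ≤ θ) (v w : Fin 2 → ℝ) : wnorm θ (v + w) ≤ wnorm θ v + wnorm θ w := by
  simp only [wnorm, Pi.add_apply]
  have h1 := abs_add_le (v 0) (w 0)
  have h2 := abs_add_le (v 1) (w 1)
  have h3 : |v 0 + w 0 - (v 1 + w 1)| ≤ |v 0 - v 1| + |w 0 - w 1| := by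
    rw [show v 0 + w 0 - (v 1 + w 1) = (v 0 - v 1) + (w 0 - w 1) by ring]
    exact abs_add_le _ _
  nlinarith

theorem wnorm_smul {θ : ℝ} (a : ℝ) (w : Fin 2 → ℝ) : wnorm θ (a • w) = |a| * wnorm θ w := by
  simp only [wnorm, Pi.smul_apply, smul_eq_mul, ← mul_sub, abs_mul]
  ring

theorem abs_apply_le_wnorm {θ : ℝ} (hθ : 0 ≤ θ) (w : Fin 2 → ℝ) (k : Fin 2) : |w k| ≤ wnorm θ w := by
  have h := mul_nonneg hθ (abs_nonneg (w 0 - w 1))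
  unfold wnorm
  have h0 := abs_nonneg (w 0)
  have h1 := abs_nonneg (w 1)
  fin_cases k <;> simp <;> linarith

theorem continuous_wnorm {θ : ℝ} : Continuous (wnorm θ) := by
  unfold wnorm; fun_prop

@[simp] theorem wnorm_zero {θ : ℝ} : wnorm θ 0 = 0 := by simp [wnorm]

theorem wnorm_sum_le {θ : ℝ} (hθ : 0 ≤ θ) {ι : Type*} (s : Finset ι) (f : ι → Fin 2 → ℝ) :
    wnorm θ (∑ i ∈ s, f i) ≤ ∑ i ∈ s, wnorm θ (f i) := by
  classical
  induction s using Finset.induction_on with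
  | empty => simp
  | insert a s ha ih =>
    rw [Finset.sum_insert ha, Finset.sum_insert ha]
    exact (wnorm_add_le hθ _ _).trans (by linarith)

/-- It suffices to test a bound for the operator norm on the extreme points of the unit ball. -/
theorem wnorm_mulVec_le {θ : ℝ} (hθ : 0 ≤ θ) (B : Matrix (Fin 2) (Fin 2) ℝ) (K : ℝ)
    (h0 : wnorm θ ![B 0 0, B 1 0] ≤ K * (1 + θ)) (h1 : wnorm θ ![B 0 1, B 1 1] ≤ K * (1 + θ))
    (h2 : wnorm θ ![B 0 0 + B 0 1, B 1 0 + B 1 1] ≤ K * 2) (w : Fin 2 → ℝ) :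
    wnorm θ (B *ᵥ w) ≤ K * wnorm θ w := by
  have key : ∀ (a b : ℝ) (u v : Fin 2 → ℝ), wnorm θ (a • u + b • v) ≤
      |a| * wnorm θ u + |b| * wnorm θ v := fun a b u v => by
    rw [← wnorm_smul, ← wnorm_smul]; exact wnorm_add_le hθ _ _
  have e : ∀ a b c : ℝ, w 0 = a + c → w 1 = b + c →
      B *ᵥ w = a • ![B 0 0, B 1 0] + b • ![B 0 1, B 1 1] +
        c • ![B 0 0 + B 0 1, B 1 0 + B 1 1] := by
    intro a b c ha hb
    funext k
    fin_cases k <;> simp [Matrix.mulVec, dotProduct, Fin.sum_univ_two, ha, hb] <;> ring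
  have main : ∀ a b c : ℝ, w 0 = a + c → w 1 = b + c →
      (1 + θ) * (|a| + |b|) + 2 * |c| ≤ wnorm θ w → wnorm θ (B *ᵥ w) ≤ K * wnorm θ w := by
    intro a b c ha hb h
    have hK : 0 ≤ K := by
      have := (wnorm_nonneg hθ _).trans h2
      linarith
    rw [e a b c ha hb]
    refine (wnorm_add_le hθ _ _).trans ?_
    rw [wnorm_smul]
    have h3 := key a b ![B 0 0, B 1 0] ![B 0 1, B 1 1]
    have h4 := mul_le_mul_of_nonneg_left h0 (abs_nonneg a)
    have h5 := mul_le_mul_of_nonneg_left h1 (abs_nonneg b)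
    have h6 := mul_le_mul_of_nonneg_left h2 (abs_nonneg c)
    have h7 := mul_le_mul_of_nonneg_left h hK
    nlinarith
  -- The unit ball is a hexagon with vertices on the axes and the diagonal. If the coordinates have
  -- the same sign, `w` is split along the diagonal and the axis of the larger one; otherwise along
  -- the two axes. The norm is additive on each of these cones.
  by_cases hs : 0 ≤ w 0 * w 1
  · by_cases hl : |w 1| ≤ |w 0|
    · refine main (w 0 - w 1) 0 (w 1) (by ring) (by ring) ?_
      have : |w 0 - w 1| = |w 0| - |w 1| := by
        rcases abs_cases (w 0) with h | h <;> rcases abs_cases (w 1) with h' | h' <;>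
          rcases abs_cases (w 0 - w 1) with h'' | h'' <;> nlinarith
      simp only [wnorm, abs_zero, this]; linarith
    · refine main 0 (w 1 - w 0) (w 0) (by ring) (by ring) ?_
      have : |w 0 - w 1| = |w 1| - |w 0| := by
        rcases abs_cases (w 0) with h | h <;> rcases abs_cases (w 1) with h' | h' <;>
          rcases abs_cases (w 0 - w 1) with h'' | h'' <;> nlinarith
      simp only [wnorm, abs_zero, abs_sub_comm (w 1) (w 0), this]; linarith
  · refine main (w 0) (w 1) 0 (by ring) (by ring) ?_
    have : |w 0 - w 1| = |w 0| + |w 1| := by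
      rcases abs_cases (w 0) with h | h <;> rcases abs_cases (w 1) with h' | h' <;>
          rcases abs_cases (w 0 - w 1) with h'' | h'' <;> nlinarith
    simp only [wnorm, abs_zero, this]; linarith

/-- The positivity assumptions on the parameters. -/
structure Positive (P : TwoPlaneParams) : Prop where
  ν : 0 < P.ν
  p_pos : 0 < P.p
  p_lt : P.p < 1
  α : 0 < P.α
  β : 0 < P.β
  δ : 0 < P.δ
  ε : 0 < P.ε
  η : 0 < P.η

/-- After a shift by a multiple of the identity, both drift matrices are nonnegative and
shrink the weighted norm: the flows contract it at rate `c`. -/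
structure Contracts (P : TwoPlaneParams) (θ c M : ℝ) : Prop where
  θ_nonneg : 0 ≤ θ
  c_pos : 0 < c
  c_le : c ≤ M
  entry_nonneg : ∀ i k l, 0 ≤ (driftMatrix P i + M • (1 : Matrix (Fin 2) (Fin 2) ℝ)) k l
  wnorm_le : ∀ i w, wnorm θ ((driftMatrix P i + M • (1 : Matrix (Fin 2) (Fin 2) ℝ)) *ᵥ w) ≤
    (M - c) * wnorm θ w

/-- The shift S makes all diagonal entries nonnegative. θ must be small so that the difference term,
which may grow along the diagonal, eats at most half of the decay there; c is then limited by θa and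
θa', the only decay available along the axis whose column sum is 0. -/
theorem exists_shift {a k a' k' : ℝ} (ha : 0 < a) (hk : 0 < k) (ha' : 0 < a') (hk' : 0 < k') :
    ∃ θ c S : ℝ, 0 < θ ∧ 0 < c ∧ c ≤ 1 / 4 ∧ θ * c ≤ c ∧ c ≤ θ * a ∧ c ≤ θ * a' ∧
      1 + 2 * a + 2 * k + 2 * a' + 2 * k' = S ∧
      θ * (1 + 2 * a + 2 * k) ≤ 1 / 2 ∧ θ * (1 + 2 * a' + 2 * k') ≤ 1 / 2 := by
  obtain ⟨S, hS⟩ : ∃ S, 1 + 2 * a + 2 * k + 2 * a' + 2 * k' = S := ⟨_, rfl⟩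
  have hS1 : 1 ≤ S := by linarith
  have hSpos : 0 < S := by linarith
  have hθS : 1 / (2 * S) * S = 1 / 2 := by field_simp
  have hθ1 : 1 / (2 * S) ≤ 1 := by rw [div_le_one (by linarith)]; linarith
  have hθpos : 0 < 1 / (2 * S) := by positivity
  have hc : 0 < min (1 / 4) (min (1 / (2 * S) * a) (1 / (2 * S) * a')) := by positivity
  refine ⟨1 / (2 * S), min (1 / 4) (min (1 / (2 * S) * a) (1 / (2 * S) * a')), S, hθpos, hc,
    min_le_left _ _, mul_le_of_le_one_left hc.le hθ1,
    (min_le_right _ _).trans (min_le_left _ _), (min_le_right _ _).trans (min_le_right _ _), hS,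
    ?_, ?_⟩ <;> rw [← hθS] <;> refine mul_le_mul_of_nonneg_left ?_ hθpos.le <;> linarith

/-- These are the three vertices of the unit ball. Along the first axis the ℓ¹ part is conserved and
only the θ term decays, by 2θa. Along the second axis and the diagonal the ℓ¹ part loses 1, which
leaves room for c ≤ 1/4 and for the θ term. -/
theorem shift_bounds {a k S θ c : ℝ} (ha : 0 < a) (hk : 0 < k) (hθ : 0 < θ) (_ : c ≤ 1 / 4)
    (hθc : θ * c ≤ c) (hca : c ≤ θ * a) (hS : 1 + 2 * a + 2 * k ≤ S)
    (hθS : θ * (1 + 2 * a + 2 * k) ≤ 1 / 2) :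
    |S - a| + |a| + θ * |S - a - a| ≤ (S - c) * (1 + θ) ∧
    |k| + |S - 1 - k| + θ * |k - (S - 1 - k)| ≤ (S - c) * (1 + θ) ∧
    |S - a + k| + |a + (S - 1 - k)| + θ * |S - a + k - (a + (S - 1 - k))| ≤ (S - c) * 2 := by
  have p1 := mul_pos hθ ha
  have p2 := mul_pos hθ hk
  refine ⟨?_, ?_, ?_⟩
  · rw [abs_of_nonneg (by linarith), abs_of_nonneg (by linarith), abs_of_nonneg (by linarith)]
    linarith
  · rw [abs_of_nonneg (by linarith), abs_of_nonneg (by linarith), abs_of_nonpos (by linarith)]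
    linarith
  · have : |S - a + k - (a + (S - 1 - k))| ≤ 1 + 2 * a + 2 * k := by
      rw [abs_le]; constructor <;> linarith
    have := mul_le_mul_of_nonneg_left this hθ.le
    rw [abs_of_nonneg (by linarith), abs_of_nonneg (by linarith)]
    linarith

theorem exists_contracts {P : TwoPlaneParams} (hP : Positive P) : ∃ θ c M, Contracts P θ c M := by
  obtain ⟨hν, hp0, hp1, hα, hβ, hδ, hε, hη⟩ := hP
  obtain ⟨a, ea⟩ : ∃ a, P.ν * P.β = a := ⟨_, rfl⟩
  obtain ⟨a', ea'⟩ : ∃ a, P.ν * P.ε = a := ⟨_, rfl⟩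
  obtain ⟨k, ek⟩ : ∃ k, P.p + P.ν * P.α = k := ⟨_, rfl⟩
  obtain ⟨k', ek'⟩ : ∃ k, (1 - P.p) + P.ν * P.δ = k := ⟨_, rfl⟩
  have ha : 0 < a := ea ▸ mul_pos hν hβ
  have ha' : 0 < a' := ea' ▸ mul_pos hν hε
  have hk : 0 < k := by rw [← ek]; positivity
  have hk' : 0 < k' := by
    have := mul_pos hν hδ; linarith
  obtain ⟨θ, c, S, hθ, hc, hc4, hθc, hca, hca', hS, h1, h2⟩ := exists_shift ha hk ha' hk'
  have eT : driftMatrix P true + S • (1 : Matrix (Fin 2) (Fin 2) ℝ) =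
      !![S - a, k; a, S - 1 - k] := by
    ext i j
    fin_cases i <;> fin_cases j <;> simp [driftMatrix, ea, ← ek] <;> ring
  have eF : driftMatrix P false + S • (1 : Matrix (Fin 2) (Fin 2) ℝ) =
      !![S - 1 - k', a'; k', S - a'] := by
    ext i j
    fin_cases i <;> fin_cases j <;> simp [driftMatrix, ea', ← ek'] <;> ring
  refine ⟨θ, c, S, hθ.le, hc, by linarith, ?_, ?_⟩
  · intro i k l
    cases i
    · rw [eF]; fin_cases k <;> fin_cases l <;> simp <;> linarith
    · rw [eT]; fin_cases k <;> fin_cases l <;> simp <;> linarith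
  · intro i w
    cases i
    -- Plane 0 is plane 1 with the coordinates exchanged, so the bounds for the two columns swap.
    · obtain ⟨b1, b2, b3⟩ := shift_bounds (S := S) ha' hk' hθ hc4 hθc hca' (by linarith) h2
      rw [eF]
      refine wnorm_mulVec_le hθ.le _ _ ?_ ?_ ?_ w
      · simpa [wnorm, abs_sub_comm, add_comm] using b2
      · simpa [wnorm, abs_sub_comm, add_comm] using b1
      · simp only [wnorm, Matrix.of_apply, Matrix.cons_val', Matrix.cons_val_zero,
          Matrix.cons_val_one, Matrix.cons_val_fin_one]
        rw [abs_sub_comm, add_comm |S - 1 - k' + a'|, add_comm k' (S - a'),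
          add_comm (S - 1 - k') a']
        exact b3
    · obtain ⟨b1, b2, b3⟩ := shift_bounds (S := S) ha hk hθ hc4 hθc hca (by linarith) h1
      rw [eT]
      exact wnorm_mulVec_le hθ.le _ _ b1 b2 b3 w

/-! ### Contraction and positivity of the matrix exponentials -/

/-- The exponential of a shifted matrix, applied to a vector, as a series. -/
theorem hasSum_exp_mulVec (A : Matrix (Fin 2) (Fin 2) ℝ) (M t : ℝ) (w : Fin 2 → ℝ) :
    HasSum (fun n : ℕ => (Real.exp (-(M * t)) * (t ^ n / n.factorial)) •
        ((A + M • (1 : Matrix (Fin 2) (Fin 2) ℝ)) ^ n *ᵥ w))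
      (NormedSpace.exp (t • A) *ᵥ w) := by
  open scoped Matrix.Norms.Operator in
  have e : NormedSpace.exp (t • A) = Real.exp (-(M * t)) •
      NormedSpace.exp (t • (A + M • (1 : Matrix (Fin 2) (Fin 2) ℝ))) := by
    have h1 : t • A = (-(M * t)) • (1 : Matrix (Fin 2) (Fin 2) ℝ) +
        t • (A + M • (1 : Matrix (Fin 2) (Fin 2) ℝ)) := by
      rw [smul_add, smul_smul]; module
    rw [h1, Matrix.exp_add_of_commute _ _
      ((Commute.one_left (t • (A + M • (1 : Matrix (Fin 2) (Fin 2) ℝ)))).smul_left (-(M * t)))]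
    have h2 : NormedSpace.exp ((-(M * t)) • (1 : Matrix (Fin 2) (Fin 2) ℝ)) =
        Real.exp (-(M * t)) • (1 : Matrix (Fin 2) (Fin 2) ℝ) := by
      rw [← Algebra.algebraMap_eq_smul_one, ← Algebra.algebraMap_eq_smul_one, Real.exp_eq_exp_ℝ]
      exact (NormedSpace.algebraMap_exp_comm (-(M * t))).symm
    rw [h2, smul_mul_assoc, one_mul]
  have h := NormedSpace.exp_series_hasSum_exp' (𝕂 := ℝ)
    (t • (A + M • (1 : Matrix (Fin 2) (Fin 2) ℝ)))
  have h' := (h.const_smul (Real.exp (-(M * t)))).mapL (LinearMap.toContinuousLinearMap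
    ((Matrix.mulVecBilin ℝ ℝ).flip w))
  rw [e]
  refine (congrArg (fun f => HasSum f _) (funext fun n => ?_)).mpr h'
  change _ = (Real.exp (-(M * t)) • ((n.factorial : ℝ)⁻¹ •
    (t • (A + M • (1 : Matrix (Fin 2) (Fin 2) ℝ))) ^ n)) *ᵥ w
  rw [smul_pow, Matrix.smul_mulVec, Matrix.smul_mulVec, Matrix.smul_mulVec, smul_smul, smul_smul]
  congr 1
  ring

/-- The shifted series is bounded term by term: exp(-Mt) Σ ((M - c)t)ⁿ/n! = exp(-ct). -/
theorem wnorm_exp_le {P : TwoPlaneParams} {θ c M : ℝ} (h : Contracts P θ c M) (i : Bool) {t : ℝ}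
    (ht : 0 ≤ t) (w : Fin 2 → ℝ) :
    wnorm θ (NormedSpace.exp (t • driftMatrix P i) *ᵥ w) ≤ Real.exp (-(c * t)) * wnorm θ w := by
  have hs := hasSum_exp_mulVec (driftMatrix P i) M t w
  set B := driftMatrix P i + M • (1 : Matrix (Fin 2) (Fin 2) ℝ)
  have hpow : ∀ n : ℕ, wnorm θ (B ^ n *ᵥ w) ≤ (M - c) ^ n * wnorm θ w := by
    intro n
    induction n with
    | zero => simp
    | succ n ih =>
      rw [pow_succ', ← Matrix.mulVec_mulVec, pow_succ', mul_assoc]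
      exact (h.wnorm_le i _).trans (mul_le_mul_of_nonneg_left ih (sub_nonneg.2 h.c_le))
  have hr : HasSum (fun n : ℕ => Real.exp (-(M * t)) * (((M - c) * t) ^ n / n.factorial) *
      wnorm θ w) (Real.exp (-(c * t)) * wnorm θ w) := by
    have h1 : HasSum (fun n : ℕ => ((M - c) * t) ^ n / n.factorial)
        (Real.exp ((M - c) * t)) := by
      rw [Real.exp_eq_exp_ℝ]
      exact NormedSpace.expSeries_div_hasSum_exp ((M - c) * t)
    have := (h1.mul_left (Real.exp (-(M * t)))).mul_right (wnorm θ w)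
    rwa [← Real.exp_add, show -(M * t) + (M - c) * t = -(c * t) by ring] at this
  refine le_of_tendsto_of_tendsto' ((continuous_wnorm.tendsto _).comp hs) hr fun s => ?_
  refine (wnorm_sum_le h.θ_nonneg s _).trans (Finset.sum_le_sum fun n _ => ?_)
  rw [wnorm_smul, abs_of_nonneg (by positivity), mul_pow]
  have := mul_le_mul_of_nonneg_left (hpow n)
    (show 0 ≤ Real.exp (-(M * t)) * (t ^ n / n.factorial) by positivity)
  refine this.trans (le_of_eq ?_)
  ring

/-- All terms of the shifted series are nonnegative; the bound keeps only the one with n = 0. -/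
theorem exp_mulVec_ge {P : TwoPlaneParams} {θ c M : ℝ} (h : Contracts P θ c M) (i : Bool) {t : ℝ}
    (ht : 0 ≤ t) {w : Fin 2 → ℝ} (hw : ∀ k, 0 ≤ w k) (k : Fin 2) :
    Real.exp (-(M * t)) * w k ≤ (NormedSpace.exp (t • driftMatrix P i) *ᵥ w) k := by
  have hs := hasSum_exp_mulVec (driftMatrix P i) M t w
  set B := driftMatrix P i + M • (1 : Matrix (Fin 2) (Fin 2) ℝ)
  have hpow : ∀ (n : ℕ) l, 0 ≤ (B ^ n *ᵥ w) l := by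
    intro n
    induction n with
    | zero => simpa using hw
    | succ n ih =>
      intro l
      rw [pow_succ', ← Matrix.mulVec_mulVec]
      exact Finset.sum_nonneg (s := Finset.univ) fun j _ => mul_nonneg (h.entry_nonneg i l j) (ih j)
  have hk := Pi.hasSum.1 hs k
  have := le_hasSum hk 0 fun n _ => by
    have := hpow n k
    simp only [Pi.smul_apply, smul_eq_mul]
    positivity
  simpa using this

theorem exp_mulVec_nonneg {P : TwoPlaneParams} {θ c M : ℝ} (h : Contracts P θ c M) (i : Bool)
    {t : ℝ} (ht : 0 ≤ t) {w : Fin 2 → ℝ} (hw : ∀ k, 0 ≤ w k) (k : Fin 2) :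
    0 ≤ (NormedSpace.exp (t • driftMatrix P i) *ᵥ w) k :=
  (mul_nonneg (Real.exp_pos _).le (hw k)).trans (exp_mulVec_ge h i ht hw k)

/-! ### The flows on the quadrant and their invariant regions -/

theorem mem_configurations_iff {s : State} : s ∈ configurations ↔ ∀ k, 0 ≤ s.2 k := by
  simp [configurations, Fin.forall_fin_two]

theorem monotoneOn_Ici_of_hasDerivAt {g g' : ℝ → ℝ} (hg : ∀ t, HasDerivAt g (g' t) t)
    (hg' : ∀ t, 0 ≤ t → 0 ≤ g' t) : MonotoneOn g (Set.Ici 0) := by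
  refine monotoneOn_of_deriv_nonneg (convex_Ici 0)
    (fun t _ => (hg t).continuousAt.continuousWithinAt)
    (fun t _ => (hg t).differentiableAt.differentiableWithinAt) fun t ht => ?_
  rw [interior_Ici] at ht
  rw [(hg t).deriv]
  exact hg' t (le_of_lt ht)

theorem continuous_exp_smul (A : Matrix (Fin 2) (Fin 2) ℝ) :
    Continuous fun t : ℝ => NormedSpace.exp (t • A) := by
  open scoped Matrix.Norms.Operator in
  exact continuous_iff_continuousAt.2 fun t => (hasDerivAt_exp_smul_const' (𝕂 := ℝ) A t).continuousAt

theorem continuous_flow (P : TwoPlaneParams) (i : Bool) :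
    Continuous fun x : ℝ × (Fin 2 → ℝ) => flow P i x.1 x.2 := by
  unfold flow
  exact continuous_const.add (((continuous_exp_smul _).comp continuous_fst).matrix_mulVec
    (continuous_snd.sub continuous_const))

theorem continuous_flow_comp {X : Type*} [TopologicalSpace X] (P : TwoPlaneParams) (i : Bool)
    {t : X → ℝ} {z : X → Fin 2 → ℝ} (ht : Continuous t) (hz : Continuous z) :
    Continuous fun x => flow P i (t x) (z x) :=
  (continuous_flow P i).comp (ht.prodMk hz)

theorem flow_add (P : TwoPlaneParams) (i : Bool) (s t : ℝ) (z : Fin 2 → ℝ) :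
    flow P i (s + t) z = flow P i s (flow P i t z) := by
  unfold flow
  rw [add_sub_cancel_left, Matrix.mulVec_mulVec, add_smul, Matrix.exp_add_of_commute _ _
    (((Commute.refl _).smul_left s).smul_right t)]

theorem flow_sub (P : TwoPlaneParams) (i : Bool) (t : ℝ) (z z' : Fin 2 → ℝ) :
    flow P i t z - flow P i t z' = NormedSpace.exp (t • driftMatrix P i) *ᵥ (z - z') := by
  unfold flow
  rw [add_sub_add_left_eq_sub, ← Matrix.mulVec_sub, sub_sub_sub_cancel_right]

theorem flow_eq (P : TwoPlaneParams) (i : Bool) (t : ℝ) (z : Fin 2 → ℝ) :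
    flow P i t z = NormedSpace.exp (t • driftMatrix P i) *ᵥ z + flow P i t 0 := by
  have := flow_sub P i t z 0
  rw [sub_zero] at this
  rw [← this, sub_add_cancel]

theorem drift_zero (P : TwoPlaneParams) (i : Bool) : drift P i 0 = fun _ => P.η := by
  cases i <;> funext k <;> fin_cases k <;> simp [drift]

/-- The velocity along a trajectory of an affine equation is itself transported by the exponential,
and the velocity at the origin is (η, η). Positivity of the exponential thus makes this trajectory
increasing. -/
theorem hasDerivAt_flow_origin {P : TwoPlaneParams} (hP : Positive P) (i : Bool) (t : ℝ)
    (k : Fin 2) : HasDerivAt (fun u => flow P i u 0 k)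
      ((NormedSpace.exp (t • driftMatrix P i) *ᵥ fun _ => P.η) k) t := by
  have h := hasDerivAt_pi.1 (hasDerivAt_flow P hP.ν hP.β hP.ε i 0 t) k
  have e : drift P i (flow P i t 0) =
      NormedSpace.exp (t • driftMatrix P i) *ᵥ fun _ => P.η := by
    rw [← drift_zero P i, drift_eq P hP.ν hP.β hP.ε, drift_eq P hP.ν hP.β hP.ε, flow,
      add_sub_cancel_left, Matrix.mulVec_mulVec, Matrix.mulVec_mulVec]
    congr 1
    open scoped Matrix.Norms.Operator in
    exact ((Commute.refl (driftMatrix P i)).smul_right t).exp_right.eq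
  rwa [e] at h

theorem flow_origin_monotoneOn {P : TwoPlaneParams} (hP : Positive P) {θ c M : ℝ}
    (hC : Contracts P θ c M) (i : Bool) (k : Fin 2) :
    MonotoneOn (fun u => flow P i u 0 k) (Set.Ici 0) :=
  monotoneOn_Ici_of_hasDerivAt (fun t => hasDerivAt_flow_origin hP i t k) fun _ ht =>
    exp_mulVec_nonneg hC i ht (fun _ => hP.η.le) k

theorem flow_origin_nonneg {P : TwoPlaneParams} (hP : Positive P) {θ c M : ℝ}
    (hC : Contracts P θ c M) (i : Bool) {t : ℝ} (ht : 0 ≤ t) (k : Fin 2) :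
    0 ≤ flow P i t 0 k := by
  have := flow_origin_monotoneOn hP hC i k (Set.self_mem_Ici) ht ht
  simpa [flow_zero] using this

theorem flow_origin_pos {P : TwoPlaneParams} (hP : Positive P) {θ c M : ℝ}
    (hC : Contracts P θ c M) (i : Bool) {t : ℝ} (ht : 0 < t) (k : Fin 2) :
    0 < flow P i t 0 k := by
  have : StrictMonoOn (fun u => flow P i u 0 k) (Set.Ici 0) := by
    refine strictMonoOn_of_deriv_pos (convex_Ici 0)
      (fun t _ => (hasDerivAt_flow_origin hP i t k).continuousAt.continuousWithinAt)
      fun t ht => ?_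
    rw [interior_Ici] at ht
    rw [(hasDerivAt_flow_origin hP i t k).deriv]
    exact (mul_pos (Real.exp_pos _) hP.η).trans_le
      (exp_mulVec_ge hC i (le_of_lt ht) (fun _ => hP.η.le) k)
  have := this (Set.self_mem_Ici) ht.le ht
  simpa [flow_zero] using this

/-- The speed at time t is at most 2η exp(-ct), since (η, η) has weighted norm 2η; the bound is its
integral. -/
theorem wnorm_flow_origin_le {P : TwoPlaneParams} (hP : Positive P) {θ c M : ℝ}
    (hC : Contracts P θ c M) (i : Bool) {t : ℝ} (ht : 0 ≤ t) :
    wnorm θ (flow P i t 0) ≤ 2 * P.η / c * (1 - Real.exp (-(c * t))) := by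
  have hc := hC.c_pos.ne'
  have hw : wnorm θ (fun _ => P.η) = 2 * P.η := by
    simp [wnorm, abs_of_pos hP.η]; ring
  have hg : ∀ t, HasDerivAt (fun t => 2 * P.η / c * (1 - Real.exp (-(c * t))))
      (Real.exp (-(c * t)) * (2 * P.η)) t := fun t => by
    have h1 : HasDerivAt (fun t => -(c * t)) (-(c * 1)) t := ((hasDerivAt_id t).const_mul c).neg
    have h2 := ((h1.exp).const_sub 1).const_mul (2 * P.η / c)
    refine h2.congr_deriv ?_
    field_simp
  -- Replacing the absolute value of the difference by multiplication with σ leaves a differentiable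
  -- quantity, whose derivative is compared; only σ = 1 and σ = -1 are needed.
  have key : ∀ σ : ℝ, |σ| ≤ 1 → flow P i t 0 0 + flow P i t 0 1 +
      θ * (σ * (flow P i t 0 0 - flow P i t 0 1)) ≤
        2 * P.η / c * (1 - Real.exp (-(c * t))) := by
    intro σ hσ
    have hd := fun t => (hg t).sub (((hasDerivAt_flow_origin hP i t 0).add
      (hasDerivAt_flow_origin hP i t 1)).add
      ((((hasDerivAt_flow_origin hP i t 0).sub (hasDerivAt_flow_origin hP i t 1)).const_mul
        σ).const_mul θ))
    have hm := monotoneOn_Ici_of_hasDerivAt hd (fun t ht => by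
      have hb := wnorm_exp_le hC i ht (fun _ => P.η)
      rw [hw] at hb
      set v := NormedSpace.exp (t • driftMatrix P i) *ᵥ fun _ => P.η
      rw [sub_nonneg]
      refine le_trans ?_ hb
      unfold wnorm
      refine add_le_add (add_le_add (le_abs_self _) (le_abs_self _))
        (mul_le_mul_of_nonneg_left ?_ hC.θ_nonneg)
      refine (le_abs_self _).trans ?_
      rw [abs_mul]
      exact mul_le_of_le_one_left (abs_nonneg _) hσ) (Set.self_mem_Ici) ht ht
    simp only [Pi.sub_apply, Pi.add_apply, flow_zero, Pi.zero_apply] at hm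
    simp only [mul_zero, neg_zero, Real.exp_zero, sub_self, add_zero] at hm
    linarith
  unfold wnorm
  rw [abs_of_nonneg (flow_origin_nonneg hP hC i ht 0),
    abs_of_nonneg (flow_origin_nonneg hP hC i ht 1)]
  rcases abs_cases (flow P i t 0 0 - flow P i t 0 1) with h | h
  · have := key 1 (by simp)
    rw [h.1]; linarith
  · have := key (-1) (by simp)
    rw [h.1]; linarith

theorem wnorm_flow_sub_le {P : TwoPlaneParams} {θ c M : ℝ} (hC : Contracts P θ c M) (i : Bool)
    {t : ℝ} (ht : 0 ≤ t) (z z' : Fin 2 → ℝ) :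
    wnorm θ (flow P i t z - flow P i t z') ≤ Real.exp (-(c * t)) * wnorm θ (z - z') := by
  rw [flow_sub]; exact wnorm_exp_le hC i ht _

theorem flow_origin_le_flow {P : TwoPlaneParams} {θ c M : ℝ} (hC : Contracts P θ c M) (i : Bool)
    {t : ℝ} (ht : 0 ≤ t) {z : Fin 2 → ℝ} (hz : ∀ k, 0 ≤ z k) (k : Fin 2) :
    flow P i t 0 k ≤ flow P i t z k := by
  rw [flow_eq P i t z]
  simpa using exp_mulVec_nonneg hC i ht hz k

theorem flow_nonneg {P : TwoPlaneParams} (hP : Positive P) {θ c M : ℝ}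
    (hC : Contracts P θ c M) (i : Bool) {t : ℝ} (ht : 0 ≤ t) {z : Fin 2 → ℝ}
    (hz : ∀ k, 0 ≤ z k) (k : Fin 2) : 0 ≤ flow P i t z k :=
  (flow_origin_nonneg hP hC i ht k).trans (flow_origin_le_flow hC i ht hz k)

/-- The states with nonnegative coordinates of weighted norm at most `B`. For large `B` the
particle never leaves this set. -/
def region (θ B : ℝ) : Set State := {s | (∀ k, 0 ≤ s.2 k) ∧ wnorm θ s.2 ≤ B}

/-- The norm after time t is at most exp(-ct) B + (1 - exp(-ct)) 2η/c, an average of two numbers not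
exceeding B. -/
theorem flow_mem_region {P : TwoPlaneParams} (hP : Positive P) {θ c M B : ℝ}
    (hC : Contracts P θ c M) (hB : 2 * P.η / c ≤ B) {s : State} (hs : s ∈ region θ B) {t : ℝ}
    (ht : 0 ≤ t) (j : Bool) : (j, flow P s.1 t s.2) ∈ region θ B := by
  refine ⟨flow_nonneg hP hC s.1 ht hs.1, ?_⟩
  change wnorm θ (flow P s.1 t s.2) ≤ B
  rw [flow_eq]
  refine (wnorm_add_le hC.θ_nonneg _ _).trans ?_
  have h1 := (wnorm_exp_le hC s.1 ht s.2).trans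
    (mul_le_mul_of_nonneg_left hs.2 (Real.exp_pos _).le)
  have h2 := wnorm_flow_origin_le hP hC s.1 ht
  have h3 : 0 ≤ 1 - Real.exp (-(c * t)) := by
    have := Real.exp_le_one_iff.2 (neg_nonpos.2 (mul_nonneg hC.c_pos.le ht)); linarith
  have h4 := mul_le_mul_of_nonneg_right hB h3
  linarith

theorem region_subset_configurations {θ B : ℝ} : region θ B ⊆ configurations :=
  fun _ hs => mem_configurations_iff.2 hs.1

theorem flow_mem_configurations {P : TwoPlaneParams} (hP : Positive P) {θ c M : ℝ}
    (hC : Contracts P θ c M) {s : State} (hs : s ∈ configurations) {t : ℝ} (ht : 0 ≤ t)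
    (j : Bool) : (j, flow P s.1 t s.2) ∈ configurations :=
  mem_configurations_iff.2 (flow_nonneg hP hC s.1 ht (mem_configurations_iff.1 hs))

theorem isCompact_region {θ B : ℝ} (hθ : 0 ≤ θ) : IsCompact (region θ B) := by
  have hcl : IsClosed (region θ B) := by
    have : region θ B = {s | ∀ k, 0 ≤ s.2 k} ∩ {s | wnorm θ s.2 ≤ B} := rfl
    rw [this]
    refine IsClosed.inter ?_ (isClosed_le (continuous_wnorm.comp continuous_snd)
      continuous_const)
    simp only [Set.ofPred_forall]
    exact isClosed_iInter fun k => isClosed_le continuous_const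
      ((continuous_apply k).comp continuous_snd)
  refine IsCompact.of_isClosed_subset
    ((isCompact_univ (X := Bool)).prod (isCompact_closedBall (0 : Fin 2 → ℝ) B)) hcl ?_
  intro s hs
  refine ⟨trivial, ?_⟩
  rw [mem_closedBall_zero_iff]
  refine (pi_norm_le_iff_of_nonneg ((wnorm_nonneg hθ _).trans hs.2)).2 fun k => ?_
  exact (abs_apply_le_wnorm hθ s.2 k).trans hs.2

/-! ### Jump rates, hazards and holding times -/

/-- The coordinate that determines the jump rate. -/
def rateIndex : Bool → Fin 2
  | true => 1
  | false => 0

theorem rate_eq (P : TwoPlaneParams) (i : Bool) (z : Fin 2 → ℝ) :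
    rate P i z = P.ν * z (rateIndex i) := by
  cases i <;> rfl

theorem continuous_rate (P : TwoPlaneParams) (i : Bool) : Continuous (rate P i) := by
  have : rate P i = fun z => P.ν * z (rateIndex i) := funext fun z => rate_eq P i z
  rw [this]; fun_prop

theorem rate_nonneg {P : TwoPlaneParams} (hP : Positive P) (i : Bool) {z : Fin 2 → ℝ}
    (hz : ∀ k, 0 ≤ z k) : 0 ≤ rate P i z := by
  rw [rate_eq]; exact mul_nonneg hP.ν.le (hz _)

theorem rate_le {P : TwoPlaneParams} (hP : Positive P) {θ B : ℝ} (hθ : 0 ≤ θ) {s : State}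
    (hs : s ∈ region θ B) : rate P s.1 s.2 ≤ P.ν * B := by
  rw [rate_eq]
  exact mul_le_mul_of_nonneg_left ((le_abs_self _).trans
    ((abs_apply_le_wnorm hθ s.2 _).trans hs.2)) hP.ν.le

theorem abs_rate_sub_le {P : TwoPlaneParams} (hP : Positive P) {θ : ℝ} (hθ : 0 ≤ θ) (i : Bool)
    (z z' : Fin 2 → ℝ) : |rate P i z - rate P i z'| ≤ P.ν * wnorm θ (z - z') := by
  rw [rate_eq, rate_eq, ← mul_sub, abs_mul, abs_of_pos hP.ν]
  exact mul_le_mul_of_nonneg_left (abs_apply_le_wnorm hθ (z - z') _) hP.ν.le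

/-- Trajectories from the quadrant dominate the one from the origin, which is increasing and
strictly positive at time 1. The bound is therefore uniform, even though the rate itself may vanish
initially. -/
theorem exists_rate_flow_ge {P : TwoPlaneParams} (hP : Positive P) {θ c M : ℝ}
    (hC : Contracts P θ c M) : ∃ g > 0, ∀ s ∈ configurations, ∀ t, 1 ≤ t →
      g ≤ rate P s.1 (flow P s.1 t s.2) := by
  have h : ∀ i, 0 < P.ν * flow P i 1 0 (rateIndex i) := fun i =>
    mul_pos hP.ν (flow_origin_pos hP hC i one_pos _)
  refine ⟨min (P.ν * flow P true 1 0 (rateIndex true))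
    (P.ν * flow P false 1 0 (rateIndex false)), lt_min (h _) (h _), ?_⟩
  intro s hs t ht
  have h0 : (0 : ℝ) ≤ t := zero_le_one.trans ht
  have h1 : P.ν * flow P s.1 1 0 (rateIndex s.1) ≤ rate P s.1 (flow P s.1 t s.2) := by
    rw [rate_eq]
    refine mul_le_mul_of_nonneg_left ?_ hP.ν.le
    exact (flow_origin_monotoneOn hP hC s.1 _ (Set.mem_Ici.2 zero_le_one) h0 ht).trans
      (flow_origin_le_flow hC s.1 h0 (mem_configurations_iff.1 hs) _)
  refine le_trans ?_ h1
  cases s.1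
  · exact min_le_right _ _
  · exact min_le_left _ _

theorem continuous_rate_flow (P : TwoPlaneParams) (s : State) :
    Continuous fun u => rate P s.1 (flow P s.1 u s.2) :=
  (continuous_rate P s.1).comp (continuous_flow_comp P s.1 continuous_id continuous_const)

theorem hasDerivAt_hazard (P : TwoPlaneParams) (s : State) (t : ℝ) :
    HasDerivAt (hazard P s) (rate P s.1 (flow P s.1 t s.2)) t :=
  (continuous_rate_flow P s).integral_hasStrictDerivAt 0 t |>.hasDerivAt

theorem continuous_hazard (P : TwoPlaneParams) (s : State) : Continuous (hazard P s) :=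
  continuous_iff_continuousAt.2 fun t => (hasDerivAt_hazard P s t).continuousAt

@[simp] theorem hazard_zero (P : TwoPlaneParams) (s : State) : hazard P s 0 = 0 := by
  simp [hazard]

theorem continuous_hazard_uncurry (P : TwoPlaneParams) (i : Bool) :
    Continuous fun x : ℝ × (Fin 2 → ℝ) => hazard P (i, x.2) x.1 := by
  unfold hazard
  refine intervalIntegral.continuous_parametric_intervalIntegral_of_continuous ?_ continuous_fst
  change Continuous fun y : (ℝ × (Fin 2 → ℝ)) × ℝ => rate P i (flow P i y.2 y.1.2)
  exact (continuous_rate P i).comp (continuous_flow_comp P i continuous_snd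
    (continuous_snd.comp continuous_fst))

theorem hazard_monotoneOn {P : TwoPlaneParams} (hP : Positive P) {θ c M : ℝ}
    (hC : Contracts P θ c M) {s : State} (hs : s ∈ configurations) :
    MonotoneOn (hazard P s) (Set.Ici 0) :=
  monotoneOn_Ici_of_hasDerivAt (hasDerivAt_hazard P s) fun _ ht => rate_nonneg hP _
    (flow_nonneg hP hC s.1 ht (mem_configurations_iff.1 hs))

theorem hazard_nonneg {P : TwoPlaneParams} (hP : Positive P) {θ c M : ℝ}
    (hC : Contracts P θ c M) {s : State} (hs : s ∈ configurations) {t : ℝ} (ht : 0 ≤ t) :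
    0 ≤ hazard P s t := by
  simpa using hazard_monotoneOn hP hC hs Set.self_mem_Ici ht ht

theorem hazard_add (P : TwoPlaneParams) (s : State) (a b : ℝ) :
    hazard P s (a + b) = hazard P s a + hazard P (s.1, flow P s.1 a s.2) b := by
  have hi := fun x y => (continuous_rate_flow P s).intervalIntegrable (μ := volume) x y
  have h := intervalIntegral.integral_add_adjacent_intervals (hi 0 a) (hi a (a + b))
  unfold hazard
  rw [← h]
  congr 1
  simp only [← flow_add]
  rw [intervalIntegral.integral_comp_add_right (fun u => rate P s.1 (flow P s.1 u s.2))]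
  congr 1 <;> ring

theorem hazard_ge {P : TwoPlaneParams} (hP : Positive P) {θ c M g : ℝ}
    (hC : Contracts P θ c M)
    (hg : ∀ s ∈ configurations, ∀ t, 1 ≤ t → g ≤ rate P s.1 (flow P s.1 t s.2))
    {s : State} (hs : s ∈ configurations) {t : ℝ} (ht : 1 ≤ t) :
    g * (t - 1) ≤ hazard P s t := by
  have h1 := hazard_add P s 1 (t - 1)
  rw [add_sub_cancel] at h1
  have h2 := hazard_nonneg hP hC hs zero_le_one
  have h3 : g * (t - 1) ≤ hazard P (s.1, flow P s.1 1 s.2) (t - 1) := by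
    have hm := monotoneOn_Ici_of_hasDerivAt (fun u =>
      (hasDerivAt_hazard P (s.1, flow P s.1 1 s.2) u).sub ((hasDerivAt_id u).const_mul g))
      (fun u hu => by
        rw [← flow_add]
        have := hg s hs (u + 1) (by linarith)
        simp only [mul_one]; linarith) Set.self_mem_Ici (show 0 ≤ t - 1 by linarith)
        (by linarith)
    simpa using hm
  linarith

theorem hazard_le {P : TwoPlaneParams} (hP : Positive P) {θ c M B : ℝ}
    (hC : Contracts P θ c M) (hB : 2 * P.η / c ≤ B) {s : State} (hs : s ∈ region θ B) {t : ℝ}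
    (ht : 0 ≤ t) : hazard P s t ≤ P.ν * B * t := by
  have hm := monotoneOn_Ici_of_hasDerivAt (fun u =>
    ((hasDerivAt_id u).const_mul (P.ν * B)).sub (hasDerivAt_hazard P s u))
    (fun u hu => by
      have := rate_le hP hC.θ_nonneg (flow_mem_region hP hC hB hs hu s.1)
      simp only [mul_one]; linarith) Set.self_mem_Ici ht ht
  simpa using hm

theorem region_nonempty_bound {P : TwoPlaneParams} (hP : Positive P) {θ c M B : ℝ}
    (hC : Contracts P θ c M) (hB : 2 * P.η / c ≤ B) : 0 < B :=
  (div_pos (mul_pos two_pos hP.η) hC.c_pos).trans_le hB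

theorem exists_le_hazard {P : TwoPlaneParams} (hP : Positive P) {θ c M : ℝ}
    (hC : Contracts P θ c M) {s : State} (hs : s ∈ configurations) (e : ℝ) :
    ∃ t, 0 ≤ t ∧ e ≤ hazard P s t := by
  obtain ⟨g, hg0, hg⟩ := exists_rate_flow_ge hP hC
  refine ⟨1 + |e| / g, by positivity, ?_⟩
  have h := hazard_ge hP hC hg hs (t := 1 + |e| / g) (by linarith [div_nonneg (abs_nonneg e) hg0.le])
  rw [add_sub_cancel_left, mul_div_cancel₀ _ hg0.ne'] at h
  exact (le_abs_self e).trans h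

theorem holdingTime_nonneg (P : TwoPlaneParams) (s : State) (e : ℝ) : 0 ≤ holdingTime P s e :=
  Real.sInf_nonneg fun _ ht => ht.1

theorem le_hazard_holdingTime {P : TwoPlaneParams} (hP : Positive P) {θ c M : ℝ}
    (hC : Contracts P θ c M) {s : State} (hs : s ∈ configurations) (e : ℝ) :
    e ≤ hazard P s (holdingTime P s e) := by
  have hcl : IsClosed {t : ℝ | 0 ≤ t ∧ e ≤ hazard P s t} :=
    (isClosed_le continuous_const continuous_id).inter
      (isClosed_le continuous_const (continuous_hazard P s))
  exact (hcl.csInf_mem (exists_le_hazard hP hC hs e) ⟨0, fun _ ht => ht.1⟩).2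

/-- The infimum is attained because the hazard is continuous and unbounded, and the hazard is
monotone. Both measurability and the law of the holding time are read off from this equivalence. -/
theorem holdingTime_le_iff {P : TwoPlaneParams} (hP : Positive P) {θ c M : ℝ}
    (hC : Contracts P θ c M) {s : State} (hs : s ∈ configurations) {e t : ℝ} (ht : 0 ≤ t) :
    holdingTime P s e ≤ t ↔ e ≤ hazard P s t := by
  refine ⟨fun h => ?_, fun h => csInf_le ⟨0, fun _ ht => ht.1⟩ ⟨ht, h⟩⟩
  exact (le_hazard_holdingTime hP hC hs e).trans
    (hazard_monotoneOn hP hC hs (holdingTime_nonneg P s e) ht h)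

theorem clock_le_mul_holdingTime {P : TwoPlaneParams} (hP : Positive P) {θ c M B : ℝ}
    (hC : Contracts P θ c M) (hB : 2 * P.η / c ≤ B) {s : State} (hs : s ∈ region θ B) (e : ℝ) :
    e ≤ P.ν * B * holdingTime P s e :=
  (le_hazard_holdingTime hP hC (region_subset_configurations hs) e).trans
    (hazard_le hP hC hB hs (holdingTime_nonneg P s e))

/-! ### Measurability and law of the holding time -/

/-- The projection to the configurations. -/
def proj (s : State) : State := (s.1, fun k => max (s.2 k) 0)

theorem continuous_proj : Continuous proj := by
  unfold proj
  exact continuous_fst.prodMk (continuous_pi fun k =>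
    ((continuous_apply k).comp continuous_snd).max continuous_const)

theorem measurable_proj : Measurable proj := continuous_proj.measurable

theorem proj_mem (s : State) : proj s ∈ configurations :=
  mem_configurations_iff.2 fun _ => le_max_right _ _

theorem proj_eq_self {s : State} (hs : s ∈ configurations) : proj s = s :=
  Prod.ext rfl (funext fun k => max_eq_left (mem_configurations_iff.1 hs k))

theorem measurable_flow (P : TwoPlaneParams) :
    Measurable fun x : State × ℝ => flow P x.1.1 x.2 x.1.2 := by
  have : Measurable fun x : Bool × ((Fin 2 → ℝ) × ℝ) => flow P x.1 x.2.2 x.2.1 :=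
    measurable_from_prod_countable_right fun i =>
      (continuous_flow_comp P i continuous_snd continuous_fst).measurable
  exact this.comp ((measurable_fst.comp measurable_fst).prodMk
    ((measurable_snd.comp measurable_fst).prodMk measurable_snd))

theorem measurable_hazard (P : TwoPlaneParams) :
    Measurable fun x : State × ℝ => hazard P x.1 x.2 := by
  have : Measurable fun x : Bool × ((Fin 2 → ℝ) × ℝ) => hazard P (x.1, x.2.1) x.2.2 :=
    measurable_from_prod_countable_right fun i =>
      ((continuous_hazard_uncurry P i).comp continuous_swap).measurable
  exact this.comp ((measurable_fst.comp measurable_fst).prodMk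
    ((measurable_snd.comp measurable_fst).prodMk measurable_snd))

/-- Outside the configurations the hazard need not be monotone; composing with `proj` makes the
description of the sublevel sets valid for every state. -/
theorem measurable_holdingTime {P : TwoPlaneParams} (hP : Positive P) {θ c M : ℝ}
    (hC : Contracts P θ c M) :
    Measurable fun x : State × ℝ => holdingTime P (proj x.1) x.2 := by
  refine measurable_of_Iic fun t => ?_
  by_cases ht : 0 ≤ t
  · have : (fun x : State × ℝ => holdingTime P (proj x.1) x.2) ⁻¹' Set.Iic t =
        {x : State × ℝ | x.2 ≤ hazard P (proj x.1) t} := by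
      ext x
      exact holdingTime_le_iff hP hC (proj_mem x.1) ht
    rw [this]
    exact measurableSet_le measurable_snd ((measurable_hazard P).comp
      ((measurable_proj.comp measurable_fst).prodMk measurable_const))
  · convert MeasurableSet.empty
    ext x
    simp only [Set.mem_preimage, Set.mem_Iic, Set.mem_empty_iff_false, iff_false]
    exact fun h => ht ((holdingTime_nonneg P _ _).trans h)

theorem expMeasure_Iic {a : ℝ} (ha : 0 ≤ a) :
    expMeasure 1 (Set.Iic a) = ENNReal.ofReal (1 - Real.exp (-a)) := by
  rw [← ofReal_cdf, cdf_expMeasure_eq one_pos, if_pos ha, one_mul]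

/-- The density of the first jump time. -/
def jumpDensity (P : TwoPlaneParams) (s : State) (t : ℝ) : ℝ :=
  rate P s.1 (flow P s.1 t s.2) * Real.exp (-hazard P s t)

theorem continuous_jumpDensity (P : TwoPlaneParams) (s : State) : Continuous (jumpDensity P s) :=
  (continuous_rate_flow P s).mul (Real.continuous_exp.comp (continuous_hazard P s).neg)

theorem jumpDensity_nonneg {P : TwoPlaneParams} (hP : Positive P) {θ c M : ℝ}
    (hC : Contracts P θ c M) {s : State} (hs : s ∈ configurations) {t : ℝ} (ht : 0 ≤ t) :
    0 ≤ jumpDensity P s t :=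
  mul_nonneg (rate_nonneg hP _ (flow_nonneg hP hC s.1 ht (mem_configurations_iff.1 hs)))
    (Real.exp_pos _).le

theorem integral_jumpDensity (P : TwoPlaneParams) (s : State) (a t : ℝ) :
    ∫ u in a..t, jumpDensity P s u = Real.exp (-hazard P s a) - Real.exp (-hazard P s t) := by
  have hd : ∀ u, HasDerivAt (fun u => -Real.exp (-hazard P s u)) (jumpDensity P s u) u :=
    fun u => ((hasDerivAt_hazard P s u).neg.exp).neg.congr_deriv (by
      rw [jumpDensity, Pi.neg_apply]; ring)
  rw [intervalIntegral.integral_eq_sub_of_hasDerivAt (fun u _ => hd u)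
    ((continuous_jumpDensity P s).intervalIntegrable _ _)]
  ring

/-- Both measures give the half-line up to a ≥ 0 the mass 1 - exp(-hazard), the density being the
derivative of that expression. -/
theorem map_holdingTime {P : TwoPlaneParams} (hP : Positive P) {θ c M : ℝ}
    (hC : Contracts P θ c M) {s : State} (hs : s ∈ configurations) :
    (expMeasure 1).map (holdingTime P s) = (volume.restrict (Set.Ioi 0)).withDensity
      fun t => ENNReal.ofReal (jumpDensity P s t) := by
  have hm : Measurable (holdingTime P s) := by
    have := (measurable_holdingTime hP hC).comp (measurable_prodMk_left (x := s))
    simpa only [Function.comp_def, proj_eq_self hs] using this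
  have := Measure.isProbabilityMeasure_map (μ := expMeasure 1) hm.aemeasurable
  refine Measure.ext_of_Iic _ _ fun a => ?_
  rw [Measure.map_apply hm measurableSet_Iic, withDensity_apply _ measurableSet_Iic,
    Measure.restrict_restrict measurableSet_Iic, Set.inter_comm, Set.Ioi_inter_Iic]
  by_cases ha : 0 ≤ a
  · have e : holdingTime P s ⁻¹' Set.Iic a = Set.Iic (hazard P s a) := by
      ext x; exact holdingTime_le_iff hP hC hs ha
    rw [e, expMeasure_Iic (hazard_nonneg hP hC hs ha), ← ofReal_integral_eq_lintegral_ofReal,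
      ← intervalIntegral.integral_of_le ha, integral_jumpDensity]
    · simp
    · exact (continuous_jumpDensity P s).integrableOn_Ioc
    · exact (ae_restrict_iff' measurableSet_Ioc).2 (ae_of_all _ fun t ht =>
        jumpDensity_nonneg hP hC hs ht.1.le)
  · have e : holdingTime P s ⁻¹' Set.Iic a = ∅ := by
      ext x
      simp only [Set.mem_preimage, Set.mem_Iic, Set.mem_empty_iff_false, iff_false]
      exact fun h => ha ((holdingTime_nonneg P _ _).trans h)
    rw [e, Set.Ioc_eq_empty (fun h => ha h.le)]
    simp

theorem integral_comp_holdingTime {P : TwoPlaneParams} (hP : Positive P) {θ c M : ℝ}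
    (hC : Contracts P θ c M) {s : State} (hs : s ∈ configurations) {F : ℝ → ℝ}
    (hF : Measurable F) :
    ∫ e, F (holdingTime P s e) ∂(expMeasure 1) =
      ∫ t in Set.Ioi 0, jumpDensity P s t * F t := by
  have hm : Measurable (holdingTime P s) := by
    have := (measurable_holdingTime hP hC).comp (measurable_prodMk_left (x := s))
    simpa only [Function.comp_def, proj_eq_self hs] using this
  rw [← integral_map hm.aemeasurable hF.aestronglyMeasurable, map_holdingTime hP hC hs,
    integral_withDensity_eq_integral_toReal_smul
      (continuous_jumpDensity P s).measurable.ennreal_ofReal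
      (ae_of_all _ fun _ => ENNReal.ofReal_lt_top)]
  refine setIntegral_congr_fun measurableSet_Ioi fun t ht => ?_
  simp only [smul_eq_mul]
  rw [ENNReal.toReal_ofReal (jumpDensity_nonneg hP hC hs (le_of_lt ht))]

/-! ### The jump chain and the restart at the first jump -/

theorem jumpTime_succ (P : TwoPlaneParams) (s : State) (ω : ℕ → ℝ) (n : ℕ) :
    jumpTime P s ω (n + 1) = jumpTime P s ω n + holdingTime P (jumpState P s ω n) (ω n) :=
  Finset.sum_range_succ _ _

@[simp] theorem jumpTime_zero (P : TwoPlaneParams) (s : State) (ω : ℕ → ℝ) :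
    jumpTime P s ω 0 = 0 := Finset.sum_range_zero _

theorem jumpTime_monotone (P : TwoPlaneParams) (s : State) (ω : ℕ → ℝ) :
    Monotone (jumpTime P s ω) :=
  monotone_nat_of_le_succ fun n => by
    rw [jumpTime_succ]; exact le_add_of_nonneg_right (holdingTime_nonneg _ _ _)

theorem jumpState_mem_configurations {P : TwoPlaneParams} (hP : Positive P) {θ c M : ℝ}
    (hC : Contracts P θ c M) {s : State} (hs : s ∈ configurations) (ω : ℕ → ℝ) (n : ℕ) :
    jumpState P s ω n ∈ configurations := by
  induction n with
  | zero => exact hs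
  | succ n ih => exact flow_mem_configurations hP hC ih (holdingTime_nonneg _ _ _) _

theorem jumpState_mem_region {P : TwoPlaneParams} (hP : Positive P) {θ c M B : ℝ}
    (hC : Contracts P θ c M) (hB : 2 * P.η / c ≤ B) {s : State} (hs : s ∈ region θ B)
    (ω : ℕ → ℝ) (n : ℕ) : jumpState P s ω n ∈ region θ B := by
  induction n with
  | zero => exact hs
  | succ n ih => exact flow_mem_region hP hC hB ih (holdingTime_nonneg _ _ _) _

theorem jumpTime_jumpCount_le (P : TwoPlaneParams) (s : State) (ω : ℕ → ℝ) {t : ℝ}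
    (ht : 0 ≤ t) : jumpTime P s ω (jumpCount P s ω t) ≤ t := by
  by_cases h : BddAbove {n : ℕ | jumpTime P s ω n ≤ t}
  · exact Nat.sSup_mem (s := {n : ℕ | jumpTime P s ω n ≤ t}) ⟨0, by simpa using ht⟩ h
  · rw [jumpCount, Nat.sSup_of_not_bddAbove h]
    simpa using ht

theorem jumpCount_eq {P : TwoPlaneParams} {s : State} {ω : ℕ → ℝ} {t : ℝ} {n : ℕ}
    (h1 : jumpTime P s ω n ≤ t) (h2 : t < jumpTime P s ω (n + 1)) : jumpCount P s ω t = n := by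
  refine IsGreatest.csSup_eq ⟨h1, fun m hm => ?_⟩
  by_contra hlt
  exact absurd ((jumpTime_monotone P s ω (Nat.lt_iff_add_one_le.1 (not_le.1 hlt))).trans hm)
    (not_le.2 h2)

theorem process_mem_region {P : TwoPlaneParams} (hP : Positive P) {θ c M B : ℝ}
    (hC : Contracts P θ c M) (hB : 2 * P.η / c ≤ B) {s : State} (hs : s ∈ region θ B)
    (ω : ℕ → ℝ) (t : ℝ≥0) : process P t s ω ∈ region θ B :=
  flow_mem_region hP hC hB (jumpState_mem_region hP hC hB hs ω _)
    (sub_nonneg.2 (jumpTime_jumpCount_le P s ω t.2)) _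

theorem jumpState_succ_eq_shift (P : TwoPlaneParams) (s : State) (ω : ℕ → ℝ) (n : ℕ) :
    jumpState P s ω (n + 1) =
      jumpState P (!s.1, flow P s.1 (holdingTime P s (ω 0)) s.2) (fun k => ω (k + 1)) n := by
  induction n with
  | zero => rfl
  | succ n ih => rw [jumpState, ih]; rfl

theorem jumpTime_succ_eq_shift (P : TwoPlaneParams) (s : State) (ω : ℕ → ℝ) (n : ℕ) :
    jumpTime P s ω (n + 1) = holdingTime P s (ω 0) +
      jumpTime P (!s.1, flow P s.1 (holdingTime P s (ω 0)) s.2) (fun k => ω (k + 1)) n := by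
  rw [jumpTime, Finset.sum_range_succ', add_comm]
  congr 1
  exact Finset.sum_congr rfl fun k _ => by rw [jumpState_succ_eq_shift]

theorem process_of_lt_holdingTime {P : TwoPlaneParams} {s : State} {ω : ℕ → ℝ} {t : ℝ≥0}
    (h : (t : ℝ) < holdingTime P s (ω 0)) : process P t s ω = (s.1, flow P s.1 t s.2) := by
  have : jumpCount P s ω t = 0 :=
    jumpCount_eq (by simp) (by simpa [jumpTime_succ, jumpState] using h)
  simp [process, this, jumpState]

theorem exists_jumpTime_between {P : TwoPlaneParams} {s : State} {ω : ℕ → ℝ} {t : ℝ}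
    (ht : 0 ≤ t) (h : ∃ n, t < jumpTime P s ω n) :
    ∃ n, jumpTime P s ω n ≤ t ∧ t < jumpTime P s ω (n + 1) := by
  classical
  obtain ⟨n, hn⟩ : ∃ n, Nat.find h = n + 1 := Nat.exists_eq_succ_of_ne_zero fun h0 => by
    have := Nat.find_spec h
    rw [h0, jumpTime_zero] at this
    exact absurd ht (not_le.2 this)
  refine ⟨n, not_lt.1 (Nat.find_min h (by omega)), hn ▸ Nat.find_spec h⟩

/-- Hypothesis `hn` rules out an accumulation of jumps before t. In that case `jumpCount` would be
the supremum of an unbounded set, which is 0 by default, and the restart identity could fail. -/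
theorem process_of_holdingTime_le {P : TwoPlaneParams} {s : State} {ω : ℕ → ℝ} {t : ℝ}
    (h : holdingTime P s (ω 0) ≤ t)
    (hn : ∃ n, t - holdingTime P s (ω 0) <
      jumpTime P (!s.1, flow P s.1 (holdingTime P s (ω 0)) s.2) (fun k => ω (k + 1)) n) :
    process P t.toNNReal s ω = process P (t - holdingTime P s (ω 0)).toNNReal
      (!s.1, flow P s.1 (holdingTime P s (ω 0)) s.2) (fun k => ω (k + 1)) := by
  obtain ⟨n, h1, h2⟩ := exists_jumpTime_between (sub_nonneg.2 h) hn
  have ht : ((t.toNNReal : ℝ≥0) : ℝ) = t :=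
    Real.coe_toNNReal _ ((holdingTime_nonneg _ _ _).trans h)
  have ht' := Real.coe_toNNReal _ (sub_nonneg.2 h)
  have e1 : jumpCount P s ω t = n + 1 := jumpCount_eq
    (by rw [jumpTime_succ_eq_shift]; linarith) (by rw [jumpTime_succ_eq_shift]; linarith)
  have e2 := jumpCount_eq h1 h2
  simp only [process, ht, ht', e1, e2]
  rw [jumpState_succ_eq_shift, jumpTime_succ_eq_shift]
  congr 2
  ring

/-! ### Measurability of the process -/

theorem measurable_jumpState {P : TwoPlaneParams} (hP : Positive P) {θ c M : ℝ}
    (hC : Contracts P θ c M) (n : ℕ) :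
    Measurable fun x : State × (ℕ → ℝ) => jumpState P (proj x.1) x.2 n := by
  induction n with
  | zero => exact measurable_proj.comp measurable_fst
  | succ n ih =>
    have hh : Measurable fun x : State × (ℕ → ℝ) =>
        holdingTime P (jumpState P (proj x.1) x.2 n) (x.2 n) := by
      have := (measurable_holdingTime hP hC).comp
        (ih.prodMk ((measurable_pi_apply n).comp measurable_snd))
      refine (congrArg Measurable (funext fun x => ?_)).mp this
      simp only [Function.comp_apply]
      rw [proj_eq_self (jumpState_mem_configurations hP hC (proj_mem _) _ _)]
    exact ((measurable_of_countable (fun b : Bool => !b)).comp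
      (measurable_fst.comp ih)).prodMk ((measurable_flow P).comp (ih.prodMk hh))

theorem measurable_jumpTime {P : TwoPlaneParams} (hP : Positive P) {θ c M : ℝ}
    (hC : Contracts P θ c M) (n : ℕ) :
    Measurable fun x : State × (ℕ → ℝ) => jumpTime P (proj x.1) x.2 n := by
  refine Finset.measurable_sum _ fun k _ => ?_
  have := (measurable_holdingTime hP hC).comp
    ((measurable_jumpState hP hC k).prodMk ((measurable_pi_apply k).comp measurable_snd))
  refine (congrArg Measurable (funext fun x => ?_)).mp this
  simp only [Function.comp_apply]
  rw [proj_eq_self (jumpState_mem_configurations hP hC (proj_mem _) _ _)]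

theorem measurable_jumpCount {P : TwoPlaneParams} (hP : Positive P) {θ c M : ℝ}
    (hC : Contracts P θ c M) :
    Measurable fun x : ℝ≥0 × (State × (ℕ → ℝ)) =>
      jumpCount P (proj x.2.1) x.2.2 (x.1 : ℝ) := by
  have hle : ∀ n, MeasurableSet {x : ℝ≥0 × (State × (ℕ → ℝ)) |
      jumpTime P (proj x.2.1) x.2.2 n ≤ x.1} := fun n =>
    measurableSet_le ((measurable_jumpTime hP hC n).comp measurable_snd)
      (measurable_coe_nnreal_real.comp measurable_fst)
  have hall : MeasurableSet {x : ℝ≥0 × (State × (ℕ → ℝ)) |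
      ∀ n, jumpTime P (proj x.2.1) x.2.2 n ≤ x.1} := by
    simp only [Set.ofPred_forall]
    exact MeasurableSet.iInter hle
  refine measurable_to_countable' fun n => ?_
  -- The last set collects the paths with infinitely many jumps up to the given time, where the
  -- count takes its default value 0.
  have : (fun x : ℝ≥0 × (State × (ℕ → ℝ)) => jumpCount P (proj x.2.1) x.2.2 (x.1 : ℝ)) ⁻¹' {n} =
      {x | jumpTime P (proj x.2.1) x.2.2 n ≤ x.1} ∩
        {x | jumpTime P (proj x.2.1) x.2.2 (n + 1) ≤ x.1}ᶜ ∪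
      {x | ∀ m, jumpTime P (proj x.2.1) x.2.2 m ≤ x.1} ∩ {_x | n = 0} := by
    ext x
    simp only [Set.mem_preimage, Set.mem_singleton_iff, Set.mem_union, Set.mem_inter_iff,
      Set.mem_ofPred_eq, Set.mem_compl_iff, not_le]
    by_cases hx : ∃ m, (x.1 : ℝ) < jumpTime P (proj x.2.1) x.2.2 m
    · obtain ⟨k, h1, h2⟩ := exists_jumpTime_between x.1.2 hx
      have hx' : ¬ ∀ m, jumpTime P (proj x.2.1) x.2.2 m ≤ x.1 := by
        push Not; exact hx
      constructor
      · intro h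
        obtain rfl : n = k := h.symm.trans (jumpCount_eq h1 h2)
        exact Or.inl ⟨h1, h2⟩
      · rintro (h | h)
        · exact jumpCount_eq h.1 h.2
        · exact absurd h.1 hx'
    · have hx' : ∀ m, jumpTime P (proj x.2.1) x.2.2 m ≤ x.1 := by
        push Not at hx; exact hx
      have h0 : jumpCount P (proj x.2.1) x.2.2 (x.1 : ℝ) = 0 := by
        refine Nat.sSup_of_not_bddAbove fun ⟨b, hb⟩ => ?_
        exact absurd (hb (hx' (b + 1))) (by omega)
      rw [h0]
      constructor
      · rintro rfl
        exact Or.inr ⟨hx', rfl⟩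
      · rintro (h | h)
        · exact absurd (hx' _) (not_le.2 h.2)
        · exact h.2.symm
  rw [this]
  exact ((hle n).inter (hle (n + 1)).compl).union (hall.inter (MeasurableSet.const _))

theorem measurable_process {P : TwoPlaneParams} (hP : Positive P) {θ c M : ℝ}
    (hC : Contracts P θ c M) :
    Measurable fun x : ℝ≥0 × (State × (ℕ → ℝ)) => process P x.1 (proj x.2.1) x.2.2 := by
  have hc := measurable_jumpCount hP hC
  have hS : Measurable fun y : ℕ × (State × (ℕ → ℝ)) => jumpState P (proj y.2.1) y.2.2 y.1 :=
    measurable_from_prod_countable_right fun n => measurable_jumpState hP hC n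
  have hT : Measurable fun y : ℕ × (State × (ℕ → ℝ)) => jumpTime P (proj y.2.1) y.2.2 y.1 :=
    measurable_from_prod_countable_right fun n => measurable_jumpTime hP hC n
  have hS' := hS.comp (hc.prodMk measurable_snd)
  have hT' := hT.comp (hc.prodMk measurable_snd)
  exact (measurable_fst.comp hS').prodMk ((measurable_flow P).comp
    (hS'.prodMk ((measurable_coe_nnreal_real.comp measurable_fst).sub hT')))

/-! ### The clocks: no explosion, and splitting off the first clock -/

theorem ae_clocks_nonneg : ∀ᵐ ω ∂clocks, ∀ k, 0 ≤ ω k := by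
  refine ae_all_iff.2 fun k => ?_
  have h0 : ∀ᵐ e ∂(expMeasure 1), 0 ≤ e := by
    rw [ae_iff]
    refine measure_mono_null (t := Set.Iic 0) (fun x hx => le_of_lt (not_le.1 hx)) ?_
    rw [expMeasure_Iic le_rfl]; simp
  exact (measurePreserving_eval_infinitePi (fun _ : ℕ => expMeasure 1) k).quasiMeasurePreserving.ae
    h0

theorem ae_clocks_frequently_gt_one : ∀ᵐ ω ∂clocks, ∀ m, ∃ k, m ≤ k ∧ 1 < ω k := by
  refine ae_all_iff.2 fun m => ?_
  rw [ae_iff]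
  set q := ENNReal.ofReal (1 - Real.exp (-1))
  have hq : q < 1 := by
    rw [← ENNReal.ofReal_one, ENNReal.ofReal_lt_ofReal_iff one_pos]
    linarith [Real.exp_pos (-1)]
  -- If no clock from index `m` on exceeds 1, then neither do the first `n` of these, an event of
  -- probability qⁿ.
  have hb : ∀ n : ℕ, clocks {ω : ℕ → ℝ | ¬ ∃ k, m ≤ k ∧ 1 < ω k} ≤ q ^ n := fun n => by
    have hp := Measure.infinitePi_pi (fun _ : ℕ => expMeasure 1) (s := Finset.Ico m (m + n))
      (t := fun _ => Set.Iic 1) fun _ _ => measurableSet_Iic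
    rw [Finset.prod_const, expMeasure_Iic zero_le_one, Nat.card_Ico, add_tsub_cancel_left] at hp
    refine le_trans (measure_mono fun ω hω => ?_) hp.le
    intro k hk
    rw [Finset.coe_Ico] at hk
    by_contra hlt
    exact hω ⟨k, hk.1, not_le.1 hlt⟩
  exact le_antisymm (ge_of_tendsto' (ENNReal.tendsto_pow_atTop_nhds_zero_of_lt_one hq) hb)
    zero_le

theorem ae_clocks_sum_unbounded : ∀ᵐ ω ∂clocks, ∀ C : ℝ, ∃ n, C < ∑ k ∈ Finset.range n, ω k := by
  filter_upwards [ae_clocks_nonneg, ae_clocks_frequently_gt_one] with ω h0 h1 C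
  by_contra! hC
  have hs := summable_of_sum_range_le h0 hC
  obtain ⟨m, hm⟩ := eventually_atTop.1
    (hs.tendsto_atTop_zero.eventually (gt_mem_nhds (zero_lt_one' ℝ)))
  obtain ⟨k, hk, hk'⟩ := h1 m
  exact absurd (hm k hk) (not_lt.2 hk'.le)

theorem mem_region_self {s : State} (hs : s ∈ configurations) {θ B : ℝ} (hB : wnorm θ s.2 ≤ B) :
    s ∈ region θ B := ⟨mem_configurations_iff.1 hs, hB⟩

theorem exists_mem_region {s : State} (hs : s ∈ configurations) (θ b : ℝ) :
    ∃ B, b ≤ B ∧ s ∈ region θ B :=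
  ⟨max b (wnorm θ s.2), le_max_left _ _, mem_region_self hs (le_max_right _ _)⟩

/-- In an invariant region the hazard grows at most at rate νB, so the jump times dominate the sums
of clocks divided by νB. The exceptional null set depends neither on the starting state nor on the
time. -/
theorem ae_exists_lt_jumpTime {P : TwoPlaneParams} (hP : Positive P) {θ c M : ℝ}
    (hC : Contracts P θ c M) :
    ∀ᵐ ω ∂clocks, ∀ s ∈ configurations, ∀ t, ∃ n, t < jumpTime P s ω n := by
  filter_upwards [ae_clocks_sum_unbounded] with ω hω s hs t
  obtain ⟨B, hB, hsB⟩ := exists_mem_region hs θ (2 * P.η / c)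
  obtain ⟨n, hn⟩ := hω (P.ν * B * t)
  refine ⟨n, ?_⟩
  have h : ∑ k ∈ Finset.range n, ω k ≤ P.ν * B * jumpTime P s ω n := by
    rw [jumpTime, Finset.mul_sum]
    exact Finset.sum_le_sum fun k _ =>
      clock_le_mul_holdingTime hP hC hB (jumpState_mem_region hP hC hB hsB ω k) _
  exact lt_of_mul_lt_mul_left (hn.trans_le h)
    (mul_pos hP.ν (region_nonempty_bound hP hC hB)).le

/-- Prepend a clock to a sequence of clocks. -/
def consClock (x : ℝ × (ℕ → ℝ)) : ℕ → ℝ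
  | 0 => x.1
  | n + 1 => x.2 n

theorem measurable_consClock : Measurable consClock := by
  refine measurable_pi_iff.2 fun n => ?_
  cases n with
  | zero => exact measurable_fst
  | succ n => exact (measurable_pi_apply n).comp measurable_snd

theorem map_consClock : ((expMeasure 1).prod clocks).map consClock = clocks := by
  refine Measure.eq_infinitePi _ fun s t ht => ?_
  classical
  obtain ⟨N, hN⟩ : ∃ N, s ⊆ Finset.range (N + 1) :=
    ⟨s.sup id, fun k hk => Finset.mem_range.2 (Nat.lt_succ_of_le (Finset.le_sup (f := id) hk))⟩
  have ht' : ∀ k, MeasurableSet (if k ∈ s then t k else Set.univ) := fun k => by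
    split_ifs
    · exact ht k
    · exact MeasurableSet.univ
  rw [Measure.map_apply measurable_consClock
    (MeasurableSet.pi s.countable_toSet fun i _ => ht i)]
  -- Coordinates outside `s` are padded with the whole line, so that the index set becomes an
  -- initial segment, whose shift is again one.
  have e : consClock ⁻¹' (Set.pi s t) = (if 0 ∈ s then t 0 else Set.univ) ×ˢ
      Set.pi (Finset.range N) fun k => if k + 1 ∈ s then t (k + 1) else Set.univ := by
    ext x
    simp only [Set.mem_preimage, Set.mem_pi, Set.mem_prod, Finset.mem_coe, Finset.mem_range]
    constructor
    · intro h
      refine ⟨?_, fun k _ => ?_⟩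
      · split_ifs with h0
        · exact h 0 h0
        · trivial
      · split_ifs with hk
        · exact h (k + 1) hk
        · trivial
    · rintro ⟨h0, h1⟩ k hk
      cases k with
      | zero => rw [if_pos hk] at h0; exact h0
      | succ k =>
        have := h1 k (by simpa using Finset.mem_range.1 (hN hk))
        rwa [if_pos hk] at this
  rw [e, Measure.prod_prod, clocks, Measure.infinitePi_pi _ fun k _ => ht' (k + 1), mul_comm,
    ← Finset.prod_range_succ' (fun k => expMeasure 1 (if k ∈ s then t k else Set.univ))]
  have : ∀ k, expMeasure 1 (if k ∈ s then t k else Set.univ) =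
      if k ∈ s then expMeasure 1 (t k) else 1 := fun k => by
    split_ifs
    · rfl
    · exact measure_univ
  simp only [this]
  rw [Finset.prod_ite_mem, Finset.inter_eq_right.2 hN]

/-! ### The semigroup: renewal equations and Markov property -/

/-- The expectation of `f` at time `t` for the particle started from (the projection of) `s`. -/
def expect (P : TwoPlaneParams) (f : State → ℝ) (t : ℝ) (s : State) : ℝ :=
  ∫ ω, f (process P t.toNNReal (proj s) ω) ∂clocks

/-- The state of the particle that starts at `s` and makes its first jump at time `t`. -/
def jumpAt (P : TwoPlaneParams) (s : State) (t : ℝ) : State := (!s.1, flow P s.1 t s.2)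

/-- The state at time `t` of the particle that starts at `s` and does not jump. -/
def stayUntil (P : TwoPlaneParams) (s : State) (t : ℝ) : State := (s.1, flow P s.1 t s.2)

theorem measurable_jumpAt (P : TwoPlaneParams) (s : State) : Measurable (jumpAt P s) :=
  measurable_const.prodMk (continuous_flow_comp P s.1 continuous_id continuous_const).measurable

theorem measurable_stayUntil (P : TwoPlaneParams) (s : State) : Measurable (stayUntil P s) :=
  measurable_const.prodMk (continuous_flow_comp P s.1 continuous_id continuous_const).measurable

theorem measurable_expect {P : TwoPlaneParams} (hP : Positive P) {θ c M : ℝ}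
    (hC : Contracts P θ c M) {f : State → ℝ} (hf : Measurable f) :
    Measurable fun x : ℝ × State => expect P f x.1 x.2 := by
  have h : Measurable fun y : (ℝ × State) × (ℕ → ℝ) =>
      f (process P y.1.1.toNNReal (proj y.1.2) y.2) :=
    hf.comp ((measurable_process hP hC).comp
      ((measurable_real_toNNReal.comp (measurable_fst.comp measurable_fst)).prodMk
        ((measurable_snd.comp measurable_fst).prodMk measurable_snd)))
  exact (h.stronglyMeasurable.integral_prod_right' (ν := clocks)).measurable

theorem measurable_expect_snd {P : TwoPlaneParams} (hP : Positive P) {θ c M : ℝ}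
    (hC : Contracts P θ c M) {f : State → ℝ} (hf : Measurable f) (t : ℝ) :
    Measurable (expect P f t) :=
  (measurable_expect hP hC hf).comp measurable_prodMk_left

theorem measurable_comp_process {P : TwoPlaneParams} (hP : Positive P) {θ c M : ℝ}
    (hC : Contracts P θ c M) {f : State → ℝ} (hf : Measurable f) (t : ℝ≥0) (s : State) :
    Measurable fun ω => f (process P t (proj s) ω) :=
  hf.comp ((measurable_process hP hC).comp (measurable_const.prodMk
    (measurable_const.prodMk measurable_id)))

theorem integrable_of_abs_le {Ω : Type*} [MeasurableSpace Ω] {μ : Measure Ω} [IsFiniteMeasure μ]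
    {f : Ω → ℝ} (hf : Measurable f) {C : ℝ} (hC : ∀ x, |f x| ≤ C) : Integrable f μ :=
  Integrable.of_bound hf.aestronglyMeasurable C (ae_of_all _ hC)

theorem intervalIntegrable_of_abs_le {A : ℝ → ℝ} (hA : Measurable A) {D : ℝ}
    (hD : ∀ v, |A v| ≤ D) (a b : ℝ) : IntervalIntegrable A volume a b :=
  (intervalIntegrable_const (c := D)).mono_fun' hA.aestronglyMeasurable (ae_of_all _ hD)

theorem abs_expect_le (P : TwoPlaneParams) {f : State → ℝ} {C : ℝ} (hC : ∀ x, |f x| ≤ C) (t : ℝ)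
    (s : State) : |expect P f t s| ≤ C := by
  have := norm_integral_le_of_norm_le_const (μ := clocks)
    (f := fun ω => f (process P t.toNNReal (proj s) ω)) (ae_of_all _ fun ω => hC _)
  simpa [expect] using this

theorem le_expect {P : TwoPlaneParams} (hP : Positive P) {θ c M B : ℝ}
    (hC : Contracts P θ c M) (hB : 2 * P.η / c ≤ B) {f : State → ℝ} (hf : Measurable f) {D : ℝ}
    (hD : ∀ x, |f x| ≤ D) {m : ℝ} (hm : ∀ s ∈ region θ B, m ≤ f s) (t : ℝ) {s : State}
    (hs : s ∈ region θ B) : m ≤ expect P f t s := by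
  have h := integral_mono (μ := clocks) (integrable_const m)
    (integrable_of_abs_le (measurable_comp_process hP hC hf t.toNNReal s) fun ω => hD _)
    (fun ω => hm _ (by
      rw [proj_eq_self (region_subset_configurations hs)]
      exact process_mem_region hP hC hB hs ω _))
  simpa [expect] using h

theorem expect_le {P : TwoPlaneParams} (hP : Positive P) {θ c M B : ℝ}
    (hC : Contracts P θ c M) (hB : 2 * P.η / c ≤ B) {f : State → ℝ} (hf : Measurable f) {D : ℝ}
    (hD : ∀ x, |f x| ≤ D) {m : ℝ} (hm : ∀ s ∈ region θ B, f s ≤ m) (t : ℝ) {s : State}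
    (hs : s ∈ region θ B) : expect P f t s ≤ m := by
  have h := integral_mono (μ := clocks)
    (integrable_of_abs_le (measurable_comp_process hP hC hf t.toNNReal s) fun ω => hD _)
    (integrable_const m) (fun ω => hm _ (by
      rw [proj_eq_self (region_subset_configurations hs)]
      exact process_mem_region hP hC hB hs ω _))
  simpa [expect] using h

/-- The renewal equation at the first jump. -/
theorem expect_renewal {P : TwoPlaneParams} (hP : Positive P) {θ c M : ℝ}
    (hC : Contracts P θ c M) {f : State → ℝ} (hf : Measurable f) {D : ℝ}
    (hD : ∀ x, |f x| ≤ D) {t : ℝ} (ht : 0 ≤ t) {s : State} (hs : s ∈ configurations) :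
    expect P f t s = Real.exp (-hazard P s t) * f (stayUntil P s t) +
      ∫ v in (0 : ℝ)..t, jumpDensity P s v * expect P f (t - v) (jumpAt P s v) := by
  set A : ℝ → ℝ := fun v => expect P f (t - v) (jumpAt P s v)
  have hA : Measurable A := (measurable_expect hP hC hf).comp
    ((measurable_const.sub measurable_id).prodMk (measurable_jumpAt P s))
  -- Given the first clock, the expectation is `f (stayUntil P s t)` plus `F` of the holding time.
  -- Subtracting that constant confines the integral to [0, t]; as the density has mass 1 -
  -- exp(-hazard) there, the constant is left with the factor exp(-hazard).
  set F : ℝ → ℝ := Set.indicator (Set.Iic t) fun v => A v - f (stayUntil P s t)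
  have hF : Measurable F := (hA.sub measurable_const).indicator measurableSet_Iic
  have hFb : ∀ v, |F v| ≤ D + D := fun v => by
    by_cases hv : v ∈ Set.Iic t
    · simp only [F, Set.indicator_of_mem hv]
      exact (abs_sub _ _).trans (add_le_add (abs_expect_le P hD _ _) (hD _))
    · simp only [F, Set.indicator_of_notMem hv, abs_zero]
      linarith [(abs_nonneg _).trans (hD s)]
  have hmh : Measurable (holdingTime P s) := by
    have := (measurable_holdingTime hP hC).comp (measurable_prodMk_left (x := s))
    simpa only [Function.comp_def, proj_eq_self hs] using this
  have hmeas : Measurable fun ω => f (process P t.toNNReal (proj s) ω) :=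
    measurable_comp_process hP hC hf _ _
  have e1 : expect P f t s = ∫ e, ∫ ω, f (process P t.toNNReal (proj s) (consClock (e, ω)))
      ∂clocks ∂(expMeasure 1) := by
    rw [expect]
    nth_rewrite 1 [← map_consClock]
    rw [integral_map measurable_consClock.aemeasurable hmeas.aestronglyMeasurable,
      integral_prod]
    exact integrable_of_abs_le (hmeas.comp measurable_consClock) fun _ => hD _
  have e2 : ∀ e, ∫ ω, f (process P t.toNNReal (proj s) (consClock (e, ω))) ∂clocks =
      f (stayUntil P s t) + F (holdingTime P s e) := by
    intro e
    rw [proj_eq_self hs]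
    by_cases hv : holdingTime P s e ≤ t
    · simp only [F, Set.indicator_of_mem (Set.mem_Iic.2 hv), add_sub_cancel, A, expect]
      refine integral_congr_ae ?_
      filter_upwards [ae_exists_lt_jumpTime hP hC] with ω hω
      have hmem : jumpAt P s (holdingTime P s e) ∈ configurations :=
        flow_mem_configurations hP hC hs (holdingTime_nonneg _ _ _) _
      rw [proj_eq_self hmem]
      exact congrArg f (process_of_holdingTime_le (ω := consClock (e, ω)) hv (hω _ hmem _))
    · have hv' : holdingTime P s e ∉ Set.Iic t := hv
      simp only [F, Set.indicator_of_notMem hv', add_zero]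
      have hc : ((t.toNNReal : ℝ≥0) : ℝ) = t := Real.coe_toNNReal _ ht
      have : ∀ ω, process P t.toNNReal s (consClock (e, ω)) = stayUntil P s t := fun ω => by
        rw [process_of_lt_holdingTime (by rw [hc]; exact not_le.1 hv), hc]; rfl
      simp [this]
  have e3 : ∫ e, F (holdingTime P s e) ∂(expMeasure 1) =
      ∫ v in (0 : ℝ)..t, jumpDensity P s v * (A v - f (stayUntil P s t)) := by
    rw [integral_comp_holdingTime hP hC hs hF, intervalIntegral.integral_of_le ht,
      ← Set.Ioi_inter_Iic, ← setIntegral_indicator measurableSet_Iic]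
    refine setIntegral_congr_fun measurableSet_Ioi fun v _ => ?_
    simp only [F, Set.indicator_apply]
    split_ifs <;> simp
  have hJ := continuous_jumpDensity P s
  have hJA : IntervalIntegrable (fun v => jumpDensity P s v * A v) volume 0 t := by
    exact (intervalIntegrable_of_abs_le hA (fun v => abs_expect_le P hD _ _) _ _).continuousOn_mul
      hJ.continuousOn
  have hFi : Integrable (fun e => F (holdingTime P s e)) (expMeasure 1) :=
    integrable_of_abs_le (hF.comp hmh) fun _ => hFb _
  rw [e1, integral_congr_ae (ae_of_all _ e2), integral_add (integrable_const _) hFi, e3]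
  have hJc : IntervalIntegrable (fun v => jumpDensity P s v * f (stayUntil P s t)) volume 0 t :=
    (hJ.mul continuous_const).intervalIntegrable _ _
  simp only [mul_sub]
  rw [intervalIntegral.integral_sub hJA hJc,
    intervalIntegral.integral_mul_const, integral_jumpDensity]
  simp
  ring

theorem measurable_expect_jumpAt {P : TwoPlaneParams} (hP : Positive P) {θ c M : ℝ}
    (hC : Contracts P θ c M) {f : State → ℝ} (hf : Measurable f) (t : ℝ) (s : State) :
    Measurable fun v => expect P f (t - v) (jumpAt P s v) :=
  (measurable_expect hP hC hf).comp
    ((measurable_const.sub measurable_id).prodMk (measurable_jumpAt P s))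

theorem measurable_expect_stayUntil {P : TwoPlaneParams} (hP : Positive P) {θ c M : ℝ}
    (hC : Contracts P θ c M) {f : State → ℝ} (hf : Measurable f) (t : ℝ) (s : State) :
    Measurable fun v => expect P f (t - v) (stayUntil P s v) :=
  (measurable_expect hP hC hf).comp
    ((measurable_const.sub measurable_id).prodMk (measurable_stayUntil P s))

theorem expect_zero {P : TwoPlaneParams} (hP : Positive P) {θ c M : ℝ}
    (hC : Contracts P θ c M) {f : State → ℝ} (hf : Measurable f) {D : ℝ}
    (hD : ∀ x, |f x| ≤ D) {s : State} (hs : s ∈ configurations) : expect P f 0 s = f s := by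
  rw [expect_renewal hP hC hf hD le_rfl hs]
  simp [stayUntil, flow_zero]

/-- Lack of memory: a particle that has not jumped by time t has the same law as one started afresh
from its current position. -/
theorem jumpDensity_add (P : TwoPlaneParams) (s : State) (t w : ℝ) :
    jumpDensity P s (t + w) =
      Real.exp (-hazard P s t) * jumpDensity P (stayUntil P s t) w := by
  rw [jumpDensity, hazard_add, add_comm t w, flow_add, neg_add, Real.exp_add, jumpDensity]
  simp only [stayUntil]
  ring

/-- The renewal equation at the first jump or at time `t`, whichever comes first. -/
theorem expect_add_renewal {P : TwoPlaneParams} (hP : Positive P) {θ c M : ℝ}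
    (hC : Contracts P θ c M) {f : State → ℝ} (hf : Measurable f) {D : ℝ}
    (hD : ∀ x, |f x| ≤ D) {t h : ℝ} (ht : 0 ≤ t) (hh : 0 ≤ h) {s : State}
    (hs : s ∈ configurations) :
    expect P f (t + h) s = Real.exp (-hazard P s t) * expect P f h (stayUntil P s t) +
      ∫ v in (0 : ℝ)..t, jumpDensity P s v * expect P f (t + h - v) (jumpAt P s v) := by
  have hi : ∀ a b, IntervalIntegrable
      (fun v => jumpDensity P s v * expect P f (t + h - v) (jumpAt P s v)) volume a b :=
    fun a b => (intervalIntegrable_of_abs_le (measurable_expect_jumpAt hP hC hf (t + h) s)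
      (fun v => abs_expect_le P hD _ _) a b).continuousOn_mul
      (continuous_jumpDensity P s).continuousOn
  have hs' : stayUntil P s t ∈ configurations := flow_mem_configurations hP hC hs ht _
  rw [expect_renewal hP hC hf hD (add_nonneg ht hh) hs, expect_renewal hP hC hf hD hh hs',
    ← intervalIntegral.integral_add_adjacent_intervals (hi 0 t) (hi t (t + h))]
  have e : ∫ v in t..(t + h), jumpDensity P s v * expect P f (t + h - v) (jumpAt P s v) =
      Real.exp (-hazard P s t) * ∫ w in (0 : ℝ)..h, jumpDensity P (stayUntil P s t) w *
        expect P f (h - w) (jumpAt P (stayUntil P s t) w) := by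
    rw [← intervalIntegral.integral_const_mul]
    have := intervalIntegral.integral_comp_add_left (a := 0) (b := h)
      (fun v => jumpDensity P s v * expect P f (t + h - v) (jumpAt P s v)) t
    rw [add_zero] at this
    rw [← this]
    refine intervalIntegral.integral_congr fun w _ => ?_
    simp only [jumpDensity_add, add_sub_add_left_eq_sub, mul_assoc]
    have : jumpAt P s (t + w) = jumpAt P (stayUntil P s t) w := by
      simp only [jumpAt, stayUntil, add_comm t w, flow_add]
    rw [this]
  have e' : stayUntil P s (t + h) = stayUntil P (stayUntil P s t) h := by
    simp only [stayUntil, add_comm t h, flow_add]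
  rw [e, e', hazard_add, neg_add, Real.exp_add]
  simp only [stayUntil]
  ring

/-- The Markov property: the expectations form a semigroup. -/
theorem expect_add {P : TwoPlaneParams} (hP : Positive P) {θ c M : ℝ}
    (hC : Contracts P θ c M) {f : State → ℝ} (hf : Measurable f) {D : ℝ}
    (hD : ∀ x, |f x| ≤ D) {t h : ℝ} (ht : 0 ≤ t) (hh : 0 ≤ h) {s : State}
    (hs : s ∈ configurations) :
    expect P f (t + h) s = expect P (expect P f h) t s := by
  obtain ⟨B, hB, hsB⟩ := exists_mem_region hs θ (2 * P.η / c)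
  have hf' := measurable_expect_snd hP hC hf h
  have hD' : ∀ x, |expect P f h x| ≤ D := abs_expect_le P hD h
  have hD0 : 0 ≤ D := (abs_nonneg _).trans (hD s)
  have hBpos := region_nonempty_bound hP hC hB
  set q := 1 - Real.exp (-(P.ν * B * t))
  have hq0 : 0 ≤ q := by
    have : Real.exp (-(P.ν * B * t)) ≤ 1 := Real.exp_le_one_iff.2
      (neg_nonpos.2 (mul_nonneg (mul_nonneg hP.ν.le hBpos.le) ht))
    simp only [q]; linarith
  have hq1 : q < 1 := by simp only [q]; linarith [Real.exp_pos (-(P.ν * B * t))]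
  -- Both sides satisfy the same renewal equation, so their difference satisfies a homogeneous one.
  -- Each use of it gains the factor q, a bound for the probability of a jump before t.
  have key : ∀ n : ℕ, ∀ τ, 0 ≤ τ → τ ≤ t → ∀ s ∈ region θ B,
      |expect P f (τ + h) s - expect P (expect P f h) τ s| ≤ q ^ n * (D + D) := by
    intro n
    induction n with
    | zero =>
      intro τ _ _ s _
      rw [pow_zero, one_mul]
      exact (abs_sub _ _).trans (add_le_add (abs_expect_le P hD _ _) (abs_expect_le P hD' _ _))
    | succ n ih =>
      intro τ hτ hτt s hs
      have hsc := region_subset_configurations hs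
      have hi1 : IntervalIntegrable
          (fun v => jumpDensity P s v * expect P f (τ + h - v) (jumpAt P s v)) volume 0 τ :=
        (intervalIntegrable_of_abs_le (measurable_expect_jumpAt hP hC hf (τ + h) s)
          (fun v => abs_expect_le P hD _ _) _ _).continuousOn_mul
          (continuous_jumpDensity P s).continuousOn
      have hi2 : IntervalIntegrable
          (fun v => jumpDensity P s v * expect P (expect P f h) (τ - v) (jumpAt P s v))
          volume 0 τ :=
        (intervalIntegrable_of_abs_le (measurable_expect_jumpAt hP hC hf' τ s)
          (fun v => abs_expect_le P hD' _ _) _ _).continuousOn_mul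
          (continuous_jumpDensity P s).continuousOn
      rw [expect_add_renewal hP hC hf hD hτ hh hsc, expect_renewal hP hC hf' hD' hτ hsc,
        add_sub_add_left_eq_sub, ← intervalIntegral.integral_sub hi1 hi2]
      have hb := intervalIntegral.norm_integral_le_of_norm_le hτ (μ := volume)
        (f := fun v => jumpDensity P s v * expect P f (τ + h - v) (jumpAt P s v) -
          jumpDensity P s v * expect P (expect P f h) (τ - v) (jumpAt P s v))
        (g := fun v => jumpDensity P s v * (q ^ n * (D + D)))
        (ae_of_all _ fun v hv => by
          rw [← mul_sub, norm_mul, Real.norm_eq_abs, Real.norm_eq_abs,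
            abs_of_nonneg (jumpDensity_nonneg hP hC hsc hv.1.le)]
          refine mul_le_mul_of_nonneg_left ?_ (jumpDensity_nonneg hP hC hsc hv.1.le)
          have := ih (τ - v) (by linarith [hv.2]) (by linarith [hv.1]) (jumpAt P s v)
            (flow_mem_region hP hC hB hs hv.1.le _)
          rwa [show τ - v + h = τ + h - v by ring] at this)
        (((continuous_jumpDensity P s).mul continuous_const).intervalIntegrable _ _)
      refine hb.trans ?_
      rw [intervalIntegral.integral_mul_const, integral_jumpDensity, pow_succ', mul_assoc]
      refine mul_le_mul_of_nonneg_right ?_ (by positivity)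
      rw [hazard_zero, neg_zero, Real.exp_zero]
      refine sub_le_sub_left (Real.exp_le_exp.2 (neg_le_neg ?_)) _
      exact (hazard_le hP hC hB hs hτ).trans
        (mul_le_mul_of_nonneg_left hτt (mul_nonneg hP.ν.le hBpos.le))
  have hlim : Tendsto (fun n : ℕ => q ^ n * (D + D)) atTop (nhds 0) := by
    simpa using (tendsto_pow_atTop_nhds_zero_of_lt_one hq0 hq1).mul_const (D + D)
  have := ge_of_tendsto' hlim fun n => key n t ht le_rfl s hsB
  exact sub_eq_zero.1 (abs_nonpos_iff.1 this)

/-- The renewal equation for jumps at constant rate `R` which are suppressed with the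
complementary probability. -/
theorem expect_uniformized {P : TwoPlaneParams} (hP : Positive P) {θ c M : ℝ}
    (hC : Contracts P θ c M) {f : State → ℝ} (hf : Measurable f) {D : ℝ}
    (hD : ∀ x, |f x| ≤ D) {t : ℝ} (ht : 0 ≤ t) {s : State} (hs : s ∈ configurations) (R : ℝ) :
    expect P f t s = Real.exp (-(R * t)) * f (stayUntil P s t) +
      ∫ v in (0 : ℝ)..t, Real.exp (-(R * v)) *
        (rate P s.1 (flow P s.1 v s.2) * expect P f (t - v) (jumpAt P s v) +
          (R - rate P s.1 (flow P s.1 v s.2)) * expect P f (t - v) (stayUntil P s v)) := by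
  set g : ℝ → ℝ := fun v => jumpDensity P s v * expect P f (t - v) (jumpAt P s v)
  have hg : ∀ a b, IntervalIntegrable g volume a b := fun a b =>
    (intervalIntegrable_of_abs_le (measurable_expect_jumpAt hP hC hf t s)
      (fun v => abs_expect_le P hD _ _) a b).continuousOn_mul
      (continuous_jumpDensity P s).continuousOn
  -- Written as an integral, the right side of `hG` is visibly absolutely continuous. No more can be
  -- expected, because `g` involves an expectation that is only bounded and measurable.
  set G : ℝ → ℝ := fun τ => expect P f t s - ∫ v in (0 : ℝ)..τ, g v
  have hG : ∀ τ ∈ Set.Icc 0 t,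
      G τ = Real.exp (-hazard P s τ) * expect P f (t - τ) (stayUntil P s τ) := by
    intro τ hτ
    have := expect_add_renewal hP hC hf hD hτ.1 (sub_nonneg.2 hτ.2) hs
    rw [add_sub_cancel] at this
    simp only [G, g]
    rw [this]; ring
  -- This factor turns exp(-hazard) into exp(-Rτ). The claim is integration by parts for `F * G`:
  -- the derivative of `G` yields the jumps, that of `F` the suppressed jumps of rate R minus the
  -- true rate.
  set F : ℝ → ℝ := fun τ => Real.exp (hazard P s τ - R * τ)
  have hF : ∀ τ, HasDerivAt F ((rate P s.1 (flow P s.1 τ s.2) - R) * F τ) τ := fun τ => by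
    have h1 := ((hasDerivAt_hazard P s τ).sub ((hasDerivAt_id τ).const_mul R)).exp
    refine h1.congr_deriv ?_
    simp only [F, Pi.sub_apply, id, mul_one]; ring
  have hFc : Continuous F := continuous_iff_continuousAt.2 fun τ => (hF τ).continuousAt
  have hFac : AbsolutelyContinuousOnInterval F 0 t := by
    refine ContDiffOn.absolutelyContinuousOnInterval (ContDiff.contDiffOn ?_)
    refine contDiff_one_iff_deriv.2 ⟨fun τ => (hF τ).differentiableAt, ?_⟩
    rw [show deriv F = _ from funext fun τ => (hF τ).deriv]
    exact ((continuous_rate_flow P s).sub continuous_const).mul hFc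
  have hGac : AbsolutelyContinuousOnInterval G 0 t :=
    ((LipschitzWith.const (expect P f t s)).lipschitzOnWith).absolutelyContinuousOnInterval.sub
      ((hg 0 t).absolutelyContinuousOnInterval_intervalIntegral (by simp))
  have hibp := hFac.integral_deriv_mul_eq_sub hGac
  have hcongr : ∫ x in (0 : ℝ)..t, deriv F x * G x + F x * deriv G x =
      -∫ v in (0 : ℝ)..t, Real.exp (-(R * v)) *
        (rate P s.1 (flow P s.1 v s.2) * expect P f (t - v) (jumpAt P s v) +
          (R - rate P s.1 (flow P s.1 v s.2)) * expect P f (t - v) (stayUntil P s v)) := by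
    rw [← intervalIntegral.integral_neg]
    refine intervalIntegral.integral_congr_ae ?_
    filter_upwards [(hg 0 t).ae_hasDerivAt_integral] with x hx hxt
    rw [Set.uIoc_of_le ht] at hxt
    have hxt' : x ∈ Set.Icc 0 t := ⟨hxt.1.le, hxt.2⟩
    have hd := hx (by rwa [Set.uIcc_of_le ht]) 0 (by simp)
    have hd' : deriv G x = -g x := (hd.const_sub (expect P f t s)).deriv
    rw [hd', (hF x).deriv, hG x hxt']
    have hexp : F x * Real.exp (-hazard P s x) = Real.exp (-(R * x)) := by
      simp only [F]; rw [← Real.exp_add]; congr 1; ring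
    simp only [g, jumpDensity]
    rw [← hexp]; ring
  have h0 : F 0 * G 0 = expect P f t s := by simp [F, G]
  have hst : stayUntil P s t ∈ configurations := flow_mem_configurations hP hC hs ht _
  have h1 : F t * G t = Real.exp (-(R * t)) * f (stayUntil P s t) := by
    rw [hG t ⟨ht, le_rfl⟩, sub_self, expect_zero hP hC hf hD hst, ← mul_assoc]
    simp only [F]; rw [← Real.exp_add]; congr 2; ring
  rw [hcongr, h0, h1] at hibp
  linarith

/-! ### Regularity of the semigroup -/

/-- Bounded measurable functions with values in `[m, N]` on the region, and Lipschitz there with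
constant `L` within each plane. -/
structure TestFunction (θ B m N L : ℝ) (f : State → ℝ) : Prop where
  measurable : Measurable f
  bounded : ∃ D, ∀ x, |f x| ≤ D
  lipschitz_nonneg : 0 ≤ L
  lower : ∀ s ∈ region θ B, m ≤ f s
  upper : ∀ s ∈ region θ B, f s ≤ N
  lipschitz : ∀ i z z', (i, z) ∈ region θ B → (i, z') ∈ region θ B →
    |f (i, z) - f (i, z')| ≤ L * wnorm θ (z - z')

theorem abs_sub_le_of_mem {a b m N : ℝ} (ha : m ≤ a) (ha' : a ≤ N) (hb : m ≤ b) (hb' : b ≤ N) :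
    |a - b| ≤ N - m := abs_le.2 ⟨by linarith, by linarith⟩

theorem integral_exp_rate_add (R c t K₁ K₂ : ℝ) :
    ∫ v in (0 : ℝ)..t, (R * Real.exp (-(R * v)) * K₁ + (R + c) * Real.exp (-((R + c) * v)) * K₂) =
      (1 - Real.exp (-(R * t))) * K₁ + (1 - Real.exp (-((R + c) * t))) * K₂ := by
  have hd : ∀ v, HasDerivAt
      (fun v => -(Real.exp (-(R * v)) * K₁ + Real.exp (-((R + c) * v)) * K₂))
      (R * Real.exp (-(R * v)) * K₁ + (R + c) * Real.exp (-((R + c) * v)) * K₂) v := by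
    intro v
    have h1 : HasDerivAt (fun v => -(R * v)) (-(R * 1)) v := ((hasDerivAt_id v).const_mul R).neg
    have h2 : HasDerivAt (fun v => -((R + c) * v)) (-((R + c) * 1)) v :=
      ((hasDerivAt_id v).const_mul (R + c)).neg
    exact ((h1.exp.mul_const K₁).add (h2.exp.mul_const K₂)).neg.congr_deriv (by ring)
  rw [intervalIntegral.integral_eq_sub_of_hasDerivAt (fun v _ => hd v)
    ((by fun_prop : Continuous fun v => R * Real.exp (-(R * v)) * K₁ +
      (R + c) * Real.exp (-((R + c) * v)) * K₂).intervalIntegrable _ _)]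
  simp
  ring

/-- This is the coupling of two particles: with weight r' both jump and with weight R - r' neither
does, which costs E in total weight R. Only the excess r - r' makes one jump without the other, at
the cost O. -/
theorem abs_weighted_sub_le {r r' R a a' b b' E O d : ℝ} (hr0 : 0 ≤ r') (hr1 : r' ≤ R)
    (ha : |a - a'| ≤ E) (hb : |b - b'| ≤ E) (hab : |a - b| ≤ O) (hr : |r - r'| ≤ d) :
    |(r * a + (R - r) * b) - (r' * a' + (R - r') * b')| ≤ R * E + d * O := by
  have e : (r * a + (R - r) * b) - (r' * a' + (R - r') * b') =
      r' * (a - a') + (R - r') * (b - b') + (r - r') * (a - b) := by ring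
  have h1 : |r' * (a - a')| ≤ r' * E := by
    rw [abs_mul, abs_of_nonneg hr0]; exact mul_le_mul_of_nonneg_left ha hr0
  have h2 : |(R - r') * (b - b')| ≤ (R - r') * E := by
    rw [abs_mul, abs_of_nonneg (sub_nonneg.2 hr1)]
    exact mul_le_mul_of_nonneg_left hb (sub_nonneg.2 hr1)
  have h3 : |(r - r') * (a - b)| ≤ d * O := by
    rw [abs_mul]; exact mul_le_mul hr hab (abs_nonneg _) ((abs_nonneg _).trans hr)
  rw [e]
  calc _ ≤ |r' * (a - a')| + |(R - r') * (b - b')| + |(r - r') * (a - b)| := abs_add_three _ _ _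
    _ ≤ _ := by linarith

/-- While the coupled particles jump together, their distance shrinks like exp(-cv), giving the term
L exp(-ct). A mismatch happens at rate at most ν exp(-cv) times the initial distance and costs at
most N - m; integrating over v gives ν/c. Uniformization at R = νB lets both particles share the
same potential jump times. -/
theorem expect_lipschitz {P : TwoPlaneParams} (hP : Positive P) {θ c M B : ℝ}
    (hC : Contracts P θ c M) (hB : 2 * P.η / c ≤ B) {m N L : ℝ} {f : State → ℝ}
    (hf : TestFunction θ B m N L f) {t : ℝ} (ht : 0 ≤ t) {i : Bool} {z z' : Fin 2 → ℝ}
    (hz : (i, z) ∈ region θ B) (hz' : (i, z') ∈ region θ B) :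
    |expect P f t (i, z) - expect P f t (i, z')| ≤
      (L * Real.exp (-(c * t)) + P.ν / c * (N - m)) * wnorm θ (z - z') := by
  obtain ⟨D, hD⟩ := hf.bounded
  have hθ := hC.θ_nonneg
  have hBpos := region_nonempty_bound hP hC hB
  have hO : 0 ≤ N - m := sub_nonneg.2 ((hf.lower _ hz).trans (hf.upper _ hz))
  set R := P.ν * B
  have hR : 0 < R := mul_pos hP.ν hBpos
  set O := N - m
  set q := 1 - Real.exp (-(R * t))
  have hq0 : 0 ≤ q := by
    have : Real.exp (-(R * t)) ≤ 1 := Real.exp_le_one_iff.2 (neg_nonpos.2 (mul_nonneg hR.le ht))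
    simp only [q]; linarith
  have hq1 : q < 1 := by simp only [q]; linarith [Real.exp_pos (-(R * t))]
  have hosc : ∀ τ, ∀ s ∈ region θ B, ∀ s' ∈ region θ B,
      |expect P f τ s - expect P f τ s'| ≤ O := fun τ s hs s' hs' =>
    abs_sub_le_of_mem (le_expect hP hC hB hf.measurable hD hf.lower τ hs)
      (expect_le hP hC hB hf.measurable hD hf.upper τ hs)
      (le_expect hP hC hB hf.measurable hD hf.lower τ hs')
      (expect_le hP hC hB hf.measurable hD hf.upper τ hs')
  -- The claimed bound reproduces itself under the uniformized equation, while the error, at first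
  -- the whole oscillation, gains a factor q at each step.
  have key : ∀ n : ℕ, ∀ τ, 0 ≤ τ → τ ≤ t → ∀ i z z', (i, z) ∈ region θ B →
      (i, z') ∈ region θ B → |expect P f τ (i, z) - expect P f τ (i, z')| ≤
        (L * Real.exp (-(c * τ)) + P.ν / c * O) * wnorm θ (z - z') + q ^ n * O := by
    intro n
    induction n with
    | zero =>
      intro τ _ _ i z z' hz hz'
      have hw := wnorm_nonneg hθ (z - z')
      have h1 : 0 ≤ (L * Real.exp (-(c * τ)) + P.ν / c * O) * wnorm θ (z - z') := by
        have := hf.lipschitz_nonneg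
        have := hP.ν
        have := hC.c_pos
        positivity
      have := hosc τ _ hz _ hz'
      rw [pow_zero, one_mul]
      linarith
    | succ n ih =>
      intro τ hτ hτt i z z' hz hz'
      set w := wnorm θ (z - z')
      have hw : 0 ≤ w := wnorm_nonneg hθ (z - z')
      have hii : ∀ s : State, IntervalIntegrable (fun v => Real.exp (-(R * v)) *
          (rate P s.1 (flow P s.1 v s.2) * expect P f (τ - v) (jumpAt P s v) +
          (R - rate P s.1 (flow P s.1 v s.2)) * expect P f (τ - v) (stayUntil P s v)))
          volume 0 τ := fun s => by
        have h1 := (intervalIntegrable_of_abs_le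
          (measurable_expect_jumpAt hP hC hf.measurable τ s)
          (fun v => abs_expect_le P hD _ _) 0 τ).continuousOn_mul
          (continuous_rate_flow P s).continuousOn
        have h2 := (intervalIntegrable_of_abs_le
          (measurable_expect_stayUntil hP hC hf.measurable τ s)
          (fun v => abs_expect_le P hD _ _) 0 τ).continuousOn_mul
          ((continuous_const (y := R)).sub (continuous_rate_flow P s)).continuousOn
        exact (h1.add h2).continuousOn_mul
          (by fun_prop : Continuous fun v => Real.exp (-(R * v))).continuousOn
      rw [expect_uniformized hP hC hf.measurable hD hτ (region_subset_configurations hz) R,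
        expect_uniformized hP hC hf.measurable hD hτ (region_subset_configurations hz') R,
        add_sub_add_comm, ← mul_sub, ← intervalIntegral.integral_sub (hii _) (hii _)]
      have hfirst : |Real.exp (-(R * τ)) *
          (f (stayUntil P (i, z) τ) - f (stayUntil P (i, z') τ))| ≤
          Real.exp (-(R * τ)) * (L * Real.exp (-(c * τ)) * w) := by
        rw [abs_mul, abs_of_pos (Real.exp_pos _)]
        refine mul_le_mul_of_nonneg_left ?_ (Real.exp_pos _).le
        refine (hf.lipschitz i _ _ (flow_mem_region hP hC hB hz hτ i)
          (flow_mem_region hP hC hB hz' hτ i)).trans ?_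
        rw [mul_assoc]
        exact mul_le_mul_of_nonneg_left (wnorm_flow_sub_le hC i hτ z z') hf.lipschitz_nonneg
      -- `K₁` collects the terms independent of the jump time v, and `K₂` multiplies exp(-cv). Since
      -- νOw = c `K₂`, the mismatch term raises the coefficient of exp(-(R + c)v) from R to R + c,
      -- so that it integrates exactly.
      set K₁ := L * Real.exp (-(c * τ)) * w + q ^ n * O
      set K₂ := P.ν / c * O * w
      have hc := hC.c_pos.ne'
      have hb := intervalIntegral.norm_integral_le_of_norm_le hτ (μ := volume)
        (f := fun v => Real.exp (-(R * v)) *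
          (rate P i (flow P i v z) * expect P f (τ - v) (jumpAt P (i, z) v) +
          (R - rate P i (flow P i v z)) * expect P f (τ - v) (stayUntil P (i, z) v)) -
          Real.exp (-(R * v)) *
          (rate P i (flow P i v z') * expect P f (τ - v) (jumpAt P (i, z') v) +
          (R - rate P i (flow P i v z')) * expect P f (τ - v) (stayUntil P (i, z') v)))
        (g := fun v => R * Real.exp (-(R * v)) * K₁ +
          (R + c) * Real.exp (-((R + c) * v)) * K₂)
        (ae_of_all _ fun v hv => by
          have hv0 := hv.1.le
          have hj := flow_mem_region hP hC hB hz hv0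
          have hj' := flow_mem_region hP hC hB hz' hv0
          have hd := wnorm_flow_sub_le hC i hv0 z z'
          have hih : ∀ j, |expect P f (τ - v) (j, flow P i v z) -
              expect P f (τ - v) (j, flow P i v z')| ≤
              K₁ + P.ν / c * O * (Real.exp (-(c * v)) * w) := fun j => by
            refine (ih (τ - v) (by linarith [hv.2]) (by linarith) j _ _ (hj j) (hj' j)).trans ?_
            have hcoef : 0 ≤ L * Real.exp (-(c * (τ - v))) + P.ν / c * O := by
              have := hf.lipschitz_nonneg
              have := hP.ν
              have := hC.c_pos
              positivity
            have h1 := mul_le_mul_of_nonneg_left hd hcoef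
            have h2 : Real.exp (-(c * (τ - v))) * Real.exp (-(c * v)) =
                Real.exp (-(c * τ)) := by
              rw [← Real.exp_add]; congr 1; ring
            have h3 : (L * Real.exp (-(c * (τ - v))) + P.ν / c * O) *
                (Real.exp (-(c * v)) * w) = L * Real.exp (-(c * τ)) * w +
                P.ν / c * O * (Real.exp (-(c * v)) * w) := by
              rw [← h2]; ring
            simp only [K₁]
            linarith
          have hmain := abs_weighted_sub_le (R := R)
            (rate_nonneg hP i (hj' i).1) (rate_le hP hθ (hj' i))
            (hih (!i)) (hih i) (hosc (τ - v) _ (hj (!i)) _ (hj i))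
            ((abs_rate_sub_le hP hθ i (flow P i v z) (flow P i v z')).trans
              (mul_le_mul_of_nonneg_left hd hP.ν.le))
          rw [← mul_sub, norm_mul, Real.norm_eq_abs, Real.norm_eq_abs,
            abs_of_pos (Real.exp_pos _)]
          refine (mul_le_mul_of_nonneg_left hmain (Real.exp_pos _).le).trans (le_of_eq ?_)
          have h4 : Real.exp (-((R + c) * v)) = Real.exp (-(R * v)) * Real.exp (-(c * v)) := by
            rw [← Real.exp_add]; congr 1; ring
          rw [h4]
          simp only [K₂]
          field_simp
          ring)
        ((by fun_prop : Continuous fun v => R * Real.exp (-(R * v)) * K₁ +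
          (R + c) * Real.exp (-((R + c) * v)) * K₂).intervalIntegrable _ _)
      rw [integral_exp_rate_add, Real.norm_eq_abs] at hb
      have hK₂ : 0 ≤ K₂ := by
        have := hP.ν
        have := hC.c_pos
        positivity
      have hqτ : 1 - Real.exp (-(R * τ)) ≤ q := by
        refine sub_le_sub_left (Real.exp_le_exp.2 (neg_le_neg ?_)) _
        exact mul_le_mul_of_nonneg_left hτt hR.le
      have h5 : (1 - Real.exp (-(R * τ))) * (q ^ n * O) ≤ q * (q ^ n * O) :=
        mul_le_mul_of_nonneg_right hqτ (by positivity)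
      have h6 := mul_nonneg (Real.exp_pos (-((R + c) * τ))).le hK₂
      refine (abs_add_le _ _).trans ((add_le_add hfirst hb).trans ?_)
      rw [pow_succ']
      simp only [K₁, K₂] at *
      linarith
  have hlim : Tendsto (fun n : ℕ => (L * Real.exp (-(c * t)) + P.ν / c * O) * wnorm θ (z - z') +
      q ^ n * O) atTop
      (nhds ((L * Real.exp (-(c * t)) + P.ν / c * O) * wnorm θ (z - z') + 0 * O)) :=
    ((tendsto_pow_atTop_nhds_zero_of_lt_one hq0 hq1).mul_const O).const_add _
  rw [zero_mul, add_zero] at hlim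
  exact ge_of_tendsto' hlim fun n => key n t ht le_rfl i z z' hz hz'

/-! ### Recurrence and the contraction estimate -/

/-- A particle which is in plane 1 at time `T` and made no jump during the last `T - 2` time
units is close to the flow of the origin. -/
theorem le_expect_of_stay {P : TwoPlaneParams} (hP : Positive P) {θ c M B : ℝ}
    (hC : Contracts P θ c M) (hB : 2 * P.η / c ≤ B) {g : State → ℝ} (hg : Measurable g) {D : ℝ}
    (hD : ∀ x, |g x| ≤ D) (hg0 : ∀ s ∈ region θ B, 0 ≤ g s) {T γ : ℝ} (hT : 2 ≤ T)
    (hγ0 : 0 ≤ γ) (hγ : ∀ z, (true, z) ∈ region θ B →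
      wnorm θ (z - flow P true T 0) ≤ 2 * B * Real.exp (-(c * (T - 2))) → γ ≤ g (true, z))
    {τ : ℝ} (hτ : T - 2 ≤ τ) (hτT : τ ≤ T) {z : Fin 2 → ℝ} (hz : (true, z) ∈ region θ B) :
    Real.exp (-(P.ν * B * T)) * γ ≤ expect P g τ (true, z) := by
  have hτ0 : 0 ≤ τ := by linarith
  have hBpos := region_nonempty_bound hP hC hB
  have hθ := hC.θ_nonneg
  have hzc := region_subset_configurations hz
  rw [expect_renewal hP hC hg hD hτ0 hzc]
  have h1 : 0 ≤ ∫ v in (0 : ℝ)..τ, jumpDensity P (true, z) v *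
      expect P g (τ - v) (jumpAt P (true, z) v) :=
    intervalIntegral.integral_nonneg hτ0 fun v hv =>
      mul_nonneg (jumpDensity_nonneg hP hC hzc hv.1)
        (le_expect hP hC hB hg hD hg0 _ (flow_mem_region hP hC hB hz hv.1 _))
  have h0 : ((true, 0) : State) ∈ region θ B := ⟨fun _ => le_rfl, by simpa using hBpos.le⟩
  have hmem := flow_mem_region hP hC hB h0 (sub_nonneg.2 hτT) true
  have hclose : wnorm θ (flow P true τ z - flow P true T 0) ≤
      2 * B * Real.exp (-(c * (T - 2))) := by
    have e : flow P true T 0 = flow P true τ (flow P true (T - τ) 0) := by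
      rw [← flow_add]; congr 1; ring
    rw [e]
    refine (wnorm_flow_sub_le hC true hτ0 _ _).trans ?_
    have h2 : wnorm θ (z - flow P true (T - τ) 0) ≤ 2 * B := by
      rw [sub_eq_add_neg, ← neg_one_smul ℝ (flow P true (T - τ) 0)]
      refine (wnorm_add_le hθ _ _).trans ?_
      rw [wnorm_smul, abs_neg, abs_one, one_mul]
      have := hz.2
      have := hmem.2
      simp only at *
      linarith
    have h3 : Real.exp (-(c * τ)) ≤ Real.exp (-(c * (T - 2))) :=
      Real.exp_le_exp.2 (neg_le_neg (mul_le_mul_of_nonneg_left hτ hC.c_pos.le))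
    rw [mul_comm (2 * B)]
    exact mul_le_mul h3 h2 (wnorm_nonneg hθ _) (Real.exp_pos _).le
  have h4 := hγ _ (flow_mem_region hP hC hB hz hτ0 true) hclose
  have h5 : Real.exp (-(P.ν * B * T)) ≤ Real.exp (-hazard P (true, z) τ) :=
    Real.exp_le_exp.2 (neg_le_neg ((hazard_le hP hC hB hz hτ0).trans
      (mul_le_mul_of_nonneg_left hτT (mul_nonneg hP.ν.le hBpos.le))))
  have h6 := mul_le_mul h5 h4 hγ0 (Real.exp_pos _).le
  exact h6.trans (le_add_of_nonneg_right h1)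

/-- From every point of the region, the particle reaches the vicinity of one reference point with
a probability that is bounded below. -/
theorem exists_minorization {P : TwoPlaneParams} (hP : Positive P) {θ c M B : ℝ}
    (hC : Contracts P θ c M) (hB : 2 * P.η / c ≤ B) {T : ℝ} (hT : 2 ≤ T) :
    ∃ κ, 0 < κ ∧ κ ≤ 1 ∧ ∀ (g : State → ℝ) (D γ : ℝ), Measurable g → (∀ x, |g x| ≤ D) →
      (∀ s ∈ region θ B, 0 ≤ g s) → 0 ≤ γ → (∀ z, (true, z) ∈ region θ B →
        wnorm θ (z - flow P true T 0) ≤ 2 * B * Real.exp (-(c * (T - 2))) → γ ≤ g (true, z)) →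
      ∀ s ∈ region θ B, κ * γ ≤ expect P g T s := by
  obtain ⟨h, hh0, hh⟩ := exists_rate_flow_ge hP hC
  have hBpos := region_nonempty_bound hP hC hB
  have hE1 : Real.exp (-(P.ν * B * T)) ≤ 1 := Real.exp_le_one_iff.2
    (neg_nonpos.2 (mul_nonneg (mul_nonneg hP.ν.le hBpos.le) (by linarith)))
  have hE0 := Real.exp_pos (-(P.ν * B * T))
  have hh1 : 0 < 1 - Real.exp (-h) := by
    have := Real.exp_lt_exp.2 (neg_lt_zero.2 hh0)
    rw [Real.exp_zero] at this
    linarith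
  have hh2 : 1 - Real.exp (-h) ≤ 1 := by linarith [Real.exp_pos (-h)]
  -- The first factor bounds the probability of leaving plane 0 within two time units: the rate is
  -- at least h during the second one. The other factor bounds that of no further jump up to T.
  refine ⟨(1 - Real.exp (-h)) * Real.exp (-(P.ν * B * T)), mul_pos hh1 hE0,
    mul_le_one₀ hh2 hE0.le hE1, ?_⟩
  intro g D γ hg hD hg0 hγ0 hγ s hs
  have hstay := fun (τ : ℝ) (h1 : T - 2 ≤ τ) (h2 : τ ≤ T) (z : Fin 2 → ℝ)
    (hz : (true, z) ∈ region θ B) =>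
    le_expect_of_stay hP hC hB hg hD hg0 hT hγ0 hγ h1 h2 hz
  have hEγ := mul_nonneg hE0.le hγ0
  obtain ⟨i, z⟩ := s
  cases i
  · have hsc := region_subset_configurations hs
    have hadd := expect_add_renewal hP hC hg hD zero_le_two (sub_nonneg.2 hT) hsc
    rw [add_sub_cancel] at hadd
    rw [hadd]
    have h1 : 0 ≤ Real.exp (-hazard P (false, z) 2) *
        expect P g (T - 2) (stayUntil P (false, z) 2) := mul_nonneg (Real.exp_pos _).le
      (le_expect hP hC hB hg hD hg0 _ (flow_mem_region hP hC hB hs zero_le_two _))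
    have h2 : ∫ v in (0 : ℝ)..2, jumpDensity P (false, z) v *
        (Real.exp (-(P.ν * B * T)) * γ) ≤ ∫ v in (0 : ℝ)..2, jumpDensity P (false, z) v *
          expect P g (T - v) (jumpAt P (false, z) v) := by
      refine intervalIntegral.integral_mono_on zero_le_two
        (((continuous_jumpDensity P _).mul continuous_const).intervalIntegrable _ _)
        ((intervalIntegrable_of_abs_le (measurable_expect_jumpAt hP hC hg T (false, z))
          (fun v => abs_expect_le P hD _ _) _ _).continuousOn_mul
          (continuous_jumpDensity P _).continuousOn) fun v hv => ?_
      refine mul_le_mul_of_nonneg_left ?_ (jumpDensity_nonneg hP hC hsc hv.1)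
      exact hstay (T - v) (by linarith [hv.2]) (by linarith [hv.1]) _
        (flow_mem_region hP hC hB hs hv.1 _)
    rw [intervalIntegral.integral_mul_const, integral_jumpDensity, hazard_zero, neg_zero,
      Real.exp_zero] at h2
    have h3 : h ≤ hazard P (false, z) 2 := by
      have := hazard_ge hP hC hh hsc one_le_two
      norm_num at this
      exact this
    have h4 : 1 - Real.exp (-h) ≤ 1 - Real.exp (-hazard P (false, z) 2) :=
      sub_le_sub_left (Real.exp_le_exp.2 (neg_le_neg h3)) _
    have h5 := mul_le_mul_of_nonneg_right h4 hEγ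
    rw [mul_assoc]
    linarith
  · have := hstay T (by linarith) le_rfl z hs
    rw [mul_assoc]
    exact (mul_le_of_le_one_left hEγ hh2).trans this

theorem expect_sub_const {P : TwoPlaneParams} (hP : Positive P) {θ c M : ℝ}
    (hC : Contracts P θ c M) {f : State → ℝ} (hf : Measurable f) {D : ℝ}
    (hD : ∀ x, |f x| ≤ D) (m t : ℝ) (s : State) :
    expect P (fun x => f x - m) t s = expect P f t s - m := by
  unfold expect
  rw [integral_sub (integrable_of_abs_le (measurable_comp_process hP hC hf _ _) fun _ => hD _)
    (integrable_const _)]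
  simp

theorem expect_const_sub {P : TwoPlaneParams} (hP : Positive P) {θ c M : ℝ}
    (hC : Contracts P θ c M) {f : State → ℝ} (hf : Measurable f) {D : ℝ}
    (hD : ∀ x, |f x| ≤ D) (m t : ℝ) (s : State) :
    expect P (fun x => m - f x) t s = m - expect P f t s := by
  unfold expect
  rw [integral_sub (integrable_const _)
    (integrable_of_abs_le (measurable_comp_process hP hC hf _ _) fun _ => hD _)]
  simp

/-- The semigroup contracts a combination of oscillation and Lipschitz constant. -/
theorem exists_contraction {P : TwoPlaneParams} (hP : Positive P) {θ c M B : ℝ}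
    (hC : Contracts P θ c M) (hB : 2 * P.η / c ≤ B) :
    ∃ T ρ w : ℝ, 0 < T ∧ 0 ≤ ρ ∧ ρ < 1 ∧ 0 ≤ w ∧ ∀ f m N L, TestFunction θ B m N L f →
      ∃ m' N' L', TestFunction θ B m' N' L' (expect P f T) ∧
        N' - m' + w * L' ≤ ρ * (N - m + w * L) := by
  have hc := hC.c_pos
  have hBpos := region_nonempty_bound hP hC hB
  have hC0 : 0 < P.ν / c := div_pos hP.ν hc
  have hν := hP.ν.ne'
  -- The condition on T does not involve κ, which is chosen afterwards and depends on T.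
  obtain ⟨T, hT2, hTs⟩ : ∃ T, 2 ≤ T ∧ 4 * (P.ν / c) * (2 * B * Real.exp (-(c * (T - 2)))) +
      Real.exp (-(c * T)) ≤ 1 / 2 := by
    have h1 : Tendsto (fun T : ℝ => Real.exp (-(c * T))) atTop (nhds 0) :=
      Real.tendsto_exp_neg_atTop_nhds_zero.comp (tendsto_id.const_mul_atTop hc)
    have h2 : Tendsto (fun T : ℝ => Real.exp (-(c * (T - 2)))) atTop (nhds 0) :=
      h1.comp (tendsto_atTop_add_const_right _ (-2) tendsto_id)
    have h3 := ((h2.const_mul (2 * B)).const_mul (4 * (P.ν / c))).add h1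
    simp only [mul_zero, add_zero] at h3
    obtain ⟨T, hT⟩ := ((eventually_ge_atTop 2).and
      (h3.eventually (ge_mem_nhds (show (0 : ℝ) < 1 / 2 by norm_num)))).exists
    exact ⟨T, hT.1, hT.2⟩
  obtain ⟨κ, hκ0, hκ1, hκ⟩ := exists_minorization hP hC hB hT2
  set ε := 2 * B * Real.exp (-(c * (T - 2)))
  have hε : 0 ≤ ε := by positivity
  -- The weight w is such that the term (ν/c)(N - m) in the new Lipschitz constant uses up half of
  -- the gain κ(N - m) in oscillation.
  refine ⟨T, 1 - κ / 2, κ / (2 * (P.ν / c)), by linarith, by linarith, by linarith,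
    by positivity, ?_⟩
  intro f m N L hf
  obtain ⟨D, hD⟩ := hf.bounded
  have hL := hf.lipschitz_nonneg
  have h0 : ((true, 0) : State) ∈ region θ B := ⟨fun _ => le_rfl, by simpa using hBpos.le⟩
  have hstar := flow_mem_region hP hC hB h0 (show 0 ≤ T by linarith) true
  have hO : 0 ≤ N - m := sub_nonneg.2 ((hf.lower _ h0).trans (hf.upper _ h0))
  set a := f (true, flow P true T 0)
  have hnear : ∀ z, (true, z) ∈ region θ B → wnorm θ (z - flow P true T 0) ≤ ε →
      |f (true, z) - a| ≤ L * ε := fun z hz hzε =>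
    (hf.lipschitz true z _ hz hstar).trans (mul_le_mul_of_nonneg_left hzε hL)
  -- Near the reference point f differs from `a` by at most Lε, so recurrence applied to f - m and N
  -- - f moves both bounds inwards. If a correction is nonpositive, the new bound is weaker than the
  -- old one, which still holds.
  refine ⟨m + κ * (a - L * ε - m), N - κ * (N - a - L * ε),
    L * Real.exp (-(c * T)) + P.ν / c * (N - m), ⟨measurable_expect_snd hP hC hf.measurable T,
      ⟨D, abs_expect_le P hD T⟩, by positivity, ?_, ?_, ?_⟩, ?_⟩
  · intro s hs
    by_cases hneg : a - L * ε - m ≤ 0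
    · have h1 := le_expect hP hC hB hf.measurable hD hf.lower T hs
      have := mul_nonpos_of_nonneg_of_nonpos hκ0.le hneg
      linarith
    · have := hκ (fun x => f x - m) (D + |m|) (a - L * ε - m) (hf.measurable.sub_const m)
        (fun x => (abs_sub _ _).trans (by linarith [hD x]))
        (fun s hs => sub_nonneg.2 (hf.lower s hs)) (le_of_lt (not_le.1 hneg))
        (fun z hz hzε => by linarith [(abs_le.1 (hnear z hz hzε)).1]) s hs
      rw [expect_sub_const hP hC hf.measurable hD] at this
      linarith
  · intro s hs
    by_cases hneg : N - a - L * ε ≤ 0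
    · have h1 := expect_le hP hC hB hf.measurable hD hf.upper T hs
      have := mul_nonpos_of_nonneg_of_nonpos hκ0.le hneg
      linarith
    · have := hκ (fun x => N - f x) (|N| + D) (N - a - L * ε) (hf.measurable.const_sub N)
        (fun x => (abs_sub _ _).trans (by linarith [hD x]))
        (fun s hs => sub_nonneg.2 (hf.upper s hs)) (le_of_lt (not_le.1 hneg))
        (fun z hz hzε => by linarith [(abs_le.1 (hnear z hz hzε)).2]) s hs
      rw [expect_const_sub hP hC hf.measurable hD] at this
      linarith
  · intro i z z' hz hz'
    exact expect_lipschitz hP hC hB hf (by linarith) hz hz'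
  · have e1 : κ / (2 * (P.ν / c)) * (P.ν / c * (N - m)) = κ / 2 * (N - m) := by
      field_simp
    have e2 : 2 * κ * ε * L = κ / (2 * (P.ν / c)) * L * (4 * (P.ν / c) * ε) := by
      field_simp; ring
    have hw : 0 ≤ κ / (2 * (P.ν / c)) * L := by positivity
    have h1 := mul_le_mul_of_nonneg_left hTs hw
    have h2 := mul_le_mul_of_nonneg_right hκ1 hw
    linarith

/-- The expectations at large times hardly depend on the time and the initial state. -/
theorem expect_asymptotically_constant {P : TwoPlaneParams} (hP : Positive P) {θ c M B : ℝ}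
    (hC : Contracts P θ c M) (hB : 2 * P.η / c ≤ B) {m N L : ℝ} {f : State → ℝ}
    (hf : TestFunction θ B m N L f) {ε : ℝ} (hε : 0 < ε) :
    ∃ t₀, 0 ≤ t₀ ∧ ∀ t ≥ t₀, ∀ t' ≥ t₀, ∀ s ∈ region θ B, ∀ s' ∈ region θ B,
      |expect P f t s - expect P f t' s'| ≤ ε := by
  obtain ⟨T, ρ, w, hT, hρ0, hρ1, hw, hstep⟩ := exists_contraction hP hC hB
  obtain ⟨D, hD⟩ := hf.bounded
  set W := N - m + w * L
  -- Bounds valid at time nT persist at all later times, because the region is invariant.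
  have key : ∀ n : ℕ, ∃ m' N', (N' - m' ≤ ρ ^ n * W) ∧ ∀ t, n * T ≤ t → ∀ s ∈ region θ B,
      m' ≤ expect P f t s ∧ expect P f t s ≤ N' := by
    intro n
    -- The auxiliary `g` is needed because the semigroup property, and so the identification with
    -- the iterates, is available only on configurations.
    have hn : ∃ m' N' L', (∃ g, TestFunction θ B m' N' L' g ∧
        ∀ s ∈ region θ B, expect P f (n * T) s = g s) ∧ N' - m' + w * L' ≤ ρ ^ n * W := by
      induction n with
      | zero =>
        refine ⟨m, N, L, ⟨f, hf, fun s hs => ?_⟩, by simp [W]⟩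
        rw [Nat.cast_zero, zero_mul, expect_zero hP hC hf.measurable hD
          (region_subset_configurations hs)]
      | succ n ih =>
        obtain ⟨m', N', L', ⟨g, hg, hgf⟩, hle⟩ := ih
        obtain ⟨m'', N'', L'', hT', hle'⟩ := hstep g m' N' L' hg
        refine ⟨m'', N'', L'', ⟨_, hT', fun s hs => ?_⟩, ?_⟩
        · rw [Nat.cast_succ, add_mul, one_mul, add_comm, expect_add hP hC hf.measurable hD hT.le
            (by positivity) (region_subset_configurations hs)]
          unfold expect at hgf ⊢
          refine integral_congr_ae (ae_of_all _ fun ω => hgf _ ?_)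
          rw [proj_eq_self (region_subset_configurations hs)]
          exact process_mem_region hP hC hB hs ω _
        · rw [pow_succ', mul_assoc]
          exact hle'.trans (mul_le_mul_of_nonneg_left hle hρ0)
    obtain ⟨m', N', L', ⟨g, hg, hgf⟩, hle⟩ := hn
    refine ⟨m', N', ?_, fun t ht s hs => ?_⟩
    · have := mul_nonneg hw hg.lipschitz_nonneg
      linarith
    · have hnT : 0 ≤ n * T := by positivity
      have e := expect_add hP hC hf.measurable hD (sub_nonneg.2 ht) hnT
        (region_subset_configurations hs)
      rw [sub_add_cancel] at e
      rw [e]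
      have hb := abs_expect_le P hD (n * T)
      have hm := measurable_expect_snd hP hC hf.measurable (n * T)
      exact ⟨le_expect hP hC hB hm hb (fun s hs => hgf s hs ▸ hg.lower s hs) _ hs,
        expect_le hP hC hB hm hb (fun s hs => hgf s hs ▸ hg.upper s hs) _ hs⟩
  have hlim : Tendsto (fun n : ℕ => ρ ^ n * W) atTop (nhds 0) := by
    simpa using (tendsto_pow_atTop_nhds_zero_of_lt_one hρ0 hρ1).mul_const W
  obtain ⟨n, hn⟩ := (hlim.eventually (ge_mem_nhds hε)).exists
  obtain ⟨m', N', hle, hbd⟩ := key n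
  refine ⟨n * T, by positivity, fun t ht t' ht' s hs s' hs' => ?_⟩
  have h1 := hbd t ht s hs
  have h2 := hbd t' ht' s' hs'
  exact (abs_sub_le_of_mem h1.1 h1.2 h2.1 h2.2).trans (hle.trans hn)

/-! ### Weak convergence and the stationary law -/

/-- Bounded continuous functions that are Lipschitz within each plane. -/
structure PlaneLipschitz (θ : ℝ) (f : State → ℝ) : Prop where
  continuous : Continuous f
  bounded : ∃ D, ∀ x, |f x| ≤ D
  lipschitz : ∃ L, 0 ≤ L ∧ ∀ i z z', |f (i, z) - f (i, z')| ≤ L * wnorm θ (z - z')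

theorem PlaneLipschitz.testFunction {θ : ℝ} {f : State → ℝ} (hf : PlaneLipschitz θ f) (B : ℝ) :
    ∃ D L, TestFunction θ B (-D) D L f := by
  obtain ⟨D, hD⟩ := hf.bounded
  obtain ⟨L, hL, h⟩ := hf.lipschitz
  exact ⟨D, L, hf.continuous.measurable, ⟨D, hD⟩, hL, fun s _ => (abs_le.1 (hD s)).1,
    fun s _ => (abs_le.1 (hD s)).2, fun i z z' _ _ => h i z z'⟩

/-- Bounded Lipschitz functions suffice for weak convergence, and within a plane the distance is the
sup distance, which is at most the weighted norm. -/
theorem tendsto_of_forall_planeLipschitz {θ : ℝ} (hθ : 0 ≤ θ) {ι : Type*} {F : Filter ι}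
    [F.IsCountablyGenerated] {μs : ι → ProbabilityMeasure State} {μ : ProbabilityMeasure State}
    (h : ∀ f, PlaneLipschitz θ f →
      Tendsto (fun i => ∫ x, f x ∂(μs i : Measure State)) F (nhds (∫ x, f x ∂(μ : Measure State)))) :
    Tendsto μs F (nhds μ) := by
  -- A metric on `Bool` is pulled back from the reals, and its topology is then replaced by the
  -- given discrete one, so that `State` keeps its topology.
  let m0 : MetricSpace Bool := MetricSpace.induced (fun b : Bool => if b then (1 : ℝ) else 0)
    (fun a b hab => by cases a <;> cases b <;> simp_all) inferInstance
  have htop : (inferInstance : TopologicalSpace Bool) = m0.toUniformSpace.toTopologicalSpace := by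
    have h1 : @DiscreteTopology Bool m0.toUniformSpace.toTopologicalSpace :=
      @Finite.instDiscreteTopology Bool m0.toUniformSpace.toTopologicalSpace _ _
    rw [h1.eq_bot]; rfl
  let m1 : MetricSpace Bool := m0.replaceTopology htop
  refine tendsto_iff_forall_lipschitz_integral_tendsto.2 fun f hb hl => ?_
  obtain ⟨D, hD⟩ := hb
  obtain ⟨L, hL⟩ := hl
  refine h f ⟨hL.continuous, ⟨|f (true, 0)| + D, fun x => ?_⟩, L, L.2, fun i z z' => ?_⟩
  · have h1 := hD x (true, 0)
    rw [Real.dist_eq] at h1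
    have h2 := abs_add_le (f (true, 0)) (f x - f (true, 0))
    rw [add_sub_cancel] at h2
    linarith
  · have h1 := hL.dist_le_mul (i, z) (i, z')
    rw [Real.dist_eq] at h1
    refine h1.trans (mul_le_mul_of_nonneg_left ?_ L.2)
    rw [Prod.dist_eq]
    refine max_le (by simpa using wnorm_nonneg hθ _) ?_
    refine (dist_pi_le_iff (wnorm_nonneg hθ _)).2 fun k => ?_
    exact abs_apply_le_wnorm hθ (z - z') k

theorem measurable_process_proj {P : TwoPlaneParams} (hP : Positive P) {θ c M : ℝ}
    (hC : Contracts P θ c M) (t : ℝ≥0) :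
    Measurable fun x : State × (ℕ → ℝ) => process P t (proj x.1) x.2 :=
  (measurable_process hP hC).comp measurable_prodMk_left

theorem process_ae_eq {P : TwoPlaneParams} {μ : ProbabilityMeasure State} (hμ : IsInitialLaw μ)
    (t : ℝ≥0) : (fun x : State × (ℕ → ℝ) => process P t (proj x.1) x.2)
      =ᵐ[(μ : Measure State).prod clocks] fun x => process P t x.1 x.2 := by
  have h : ∀ᵐ x ∂((μ : Measure State).prod clocks), x.1 ∈ configurations :=
    Measure.quasiMeasurePreserving_fst.ae hμ
  filter_upwards [h] with x hx
  rw [proj_eq_self hx]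

theorem aemeasurable_process {P : TwoPlaneParams} (hP : Positive P) {θ c M : ℝ}
    (hC : Contracts P θ c M) {μ : ProbabilityMeasure State} (hμ : IsInitialLaw μ) (t : ℝ≥0) :
    AEMeasurable (fun x : State × (ℕ → ℝ) => process P t x.1 x.2)
      ((μ : Measure State).prod clocks) :=
  (measurable_process_proj hP hC t).aemeasurable.congr (process_ae_eq hμ t)

theorem integral_map_process {P : TwoPlaneParams} (hP : Positive P) {θ c M : ℝ}
    (hC : Contracts P θ c M) {μ : ProbabilityMeasure State} (hμ : IsInitialLaw μ) (t : ℝ≥0)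
    {f : State → ℝ} (hf : Measurable f) {D : ℝ} (hD : ∀ x, |f x| ≤ D) :
    ∫ y, f y ∂(((μ : Measure State).prod clocks).map fun x => process P t x.1 x.2) =
      ∫ s, expect P f t s ∂(μ : Measure State) := by
  rw [Measure.map_congr (process_ae_eq hμ t).symm,
    integral_map (measurable_process_proj hP hC t).aemeasurable hf.aestronglyMeasurable,
    integral_prod]
  · refine integral_congr_ae (ae_of_all _ fun s => ?_)
    simp only [expect, Real.toNNReal_coe]
  · exact integrable_of_abs_le (hf.comp (measurable_process_proj hP hC t)) fun _ => hD _

theorem measurable_process_apply {P : TwoPlaneParams} (hP : Positive P) {θ c M : ℝ}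
    (hC : Contracts P θ c M) {s : State} (hs : s ∈ configurations) (t : ℝ≥0) :
    Measurable (process P t s) := by
  have := (measurable_process_proj hP hC t).comp (measurable_prodMk_left (x := s))
  simpa only [Function.comp_def, proj_eq_self hs] using this

theorem integral_map_process_apply {P : TwoPlaneParams} (hP : Positive P) {θ c M : ℝ}
    (hC : Contracts P θ c M) {s : State} (hs : s ∈ configurations) (t : ℝ≥0)
    {f : State → ℝ} (hf : Measurable f) :
    ∫ y, f y ∂(clocks.map (process P t s)) = expect P f t s := by
  rw [integral_map (measurable_process_apply hP hC hs t).aemeasurable hf.aestronglyMeasurable]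
  simp only [expect, Real.toNNReal_coe, proj_eq_self hs]

/-- The Feller property. -/
theorem continuous_expect {P : TwoPlaneParams} (hP : Positive P) {θ c M : ℝ}
    (hC : Contracts P θ c M) {f : State → ℝ} (hf : PlaneLipschitz θ f) {t : ℝ} (ht : 0 ≤ t) :
    Continuous (expect P f t) := by
  have hproj : ∀ s, expect P f t s = expect P f t (proj s) := fun s => by
    simp only [expect, proj_eq_self (proj_mem s)]
  rw [continuous_iff_continuousAt]
  rintro ⟨i, z⟩
  set p : State → Fin 2 → ℝ := fun s => (proj s).2
  have hp : Continuous p := continuous_snd.comp continuous_proj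
  -- The margin 1 lets one region contain the projections of a whole neighbourhood.
  set B := max (2 * P.η / c) (wnorm θ (p (i, z)) + 1)
  have hB : 2 * P.η / c ≤ B := le_max_left _ _
  obtain ⟨D, L, hT⟩ := hf.testFunction B
  have hev1 : ∀ᶠ s : State in nhds (i, z), s.1 = i :=
    (continuous_fst.tendsto (i, z)).eventually (eventually_of_mem
      ((isOpen_discrete {i}).mem_nhds rfl) fun _ h => h)
  have hev2 : ∀ᶠ s : State in nhds (i, z), wnorm θ (p s) < wnorm θ (p (i, z)) + 1 :=
    ((continuous_wnorm.comp hp).tendsto (i, z)).eventually (gt_mem_nhds (lt_add_one _))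
  have hreg : ∀ s : State, wnorm θ (p s) ≤ wnorm θ (p (i, z)) + 1 → proj s ∈ region θ B :=
    fun s hs => mem_region_self (proj_mem s) (hs.trans (le_max_right _ _))
  rw [ContinuousAt, tendsto_iff_dist_tendsto_zero]
  have hlim : Tendsto (fun s => (L * Real.exp (-(c * t)) + P.ν / c * (D - -D)) *
      wnorm θ (p s - p (i, z))) (nhds (i, z)) (nhds 0) := by
    have : Continuous fun s => (L * Real.exp (-(c * t)) + P.ν / c * (D - -D)) *
      wnorm θ (p s - p (i, z)) :=
      continuous_const.mul (continuous_wnorm.comp (hp.sub continuous_const))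
    simpa using this.tendsto (i, z)
  refine squeeze_zero' (Eventually.of_forall fun _ => dist_nonneg) ?_ hlim
  filter_upwards [hev1, hev2] with s h1 h2
  rw [hproj s, hproj (i, z), Real.dist_eq]
  obtain ⟨j, y⟩ := s
  obtain rfl : j = i := h1
  exact expect_lipschitz hP hC hB hT ht (hreg _ h2.le) (hreg _ (le_add_of_nonneg_right zero_le_one))

/-- The law at time `t` of the particle started from a configuration. -/
def lawFrom (P : TwoPlaneParams) (s : State) (h : ∀ t, Measurable (process P t s)) (t : ℝ≥0) :
    ProbabilityMeasure State :=
  ⟨clocks.map (process P t s), Measure.isProbabilityMeasure_map (h t).aemeasurable⟩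

/-- All laws started from the origin of plane 1 are carried by one compact region, so they have a
cluster point. Asymptotic constancy turns it into the limit along all times and from every
configuration. -/
theorem exists_limit_law {P : TwoPlaneParams} (hP : Positive P) {θ c M : ℝ}
    (hC : Contracts P θ c M) : ∃ π : ProbabilityMeasure State, IsInitialLaw π ∧
      (∀ f, PlaneLipschitz θ f → ∀ s ∈ configurations,
        Tendsto (fun t : ℝ≥0 => expect P f t s) atTop (nhds (∫ x, f x ∂(π : Measure State)))) ∧
      ∀ f, PlaneLipschitz θ f → ∀ h : ℝ≥0,
        ∫ s, expect P f h s ∂(π : Measure State) = ∫ s, f s ∂(π : Measure State) := by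
  have hθ := hC.θ_nonneg
  set s₀ : State := (true, 0)
  set B₀ := 2 * P.η / c
  have hB₀ := region_nonempty_bound hP hC (le_refl B₀)
  have hs₀ : s₀ ∈ region θ B₀ := ⟨fun _ => le_rfl, by simpa [s₀] using hB₀.le⟩
  have hs₀c := region_subset_configurations hs₀
  have hmeas := measurable_process_apply hP hC hs₀c
  set F := lawFrom P s₀ hmeas
  have htight : IsTightMeasureSet {((μ : ProbabilityMeasure State) : Measure State) |
      μ ∈ Set.range F} := by
    rw [isTightMeasureSet_iff_exists_isCompact_measure_compl_le]
    intro ε _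
    refine ⟨region θ B₀, isCompact_region hθ, ?_⟩
    rintro _ ⟨_, ⟨t, rfl⟩, rfl⟩
    have : (clocks.map (process P t s₀)) (region θ B₀)ᶜ = 0 := by
      rw [Measure.map_apply (hmeas t) (isCompact_region hθ).isClosed.measurableSet.compl]
      refine measure_mono_null (t := ∅) (fun ω hω => ?_) measure_empty
      exact hω (process_mem_region hP hC le_rfl hs₀ ω t)
    exact this.le.trans zero_le
  have hcomp := isCompact_closure_of_isTightMeasureSet htight
  set 𝒰 : Ultrafilter ℝ≥0 := Ultrafilter.of atTop
  have h𝒰 : (𝒰 : Filter ℝ≥0) ≤ atTop := Ultrafilter.of_le atTop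
  obtain ⟨π, -, hπ⟩ := isCompact_iff_ultrafilter_le_nhds.1 hcomp (𝒰.map F)
    (le_principal_iff.2 (mem_map.2 (Eventually.of_forall fun t =>
      subset_closure (Set.mem_range_self t))))
  have hFπ : Tendsto F 𝒰 (nhds π) := hπ
  have htest : ∀ (f : State → ℝ), Continuous f → (∃ D, ∀ x, |f x| ≤ D) →
      Tendsto (fun t : ℝ≥0 => expect P f t s₀) 𝒰 (nhds (∫ x, f x ∂(π : Measure State))) := by
    rintro f hf ⟨D, hD⟩
    have := ProbabilityMeasure.tendsto_iff_forall_integral_tendsto.1 hFπ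
      (BoundedContinuousFunction.ofNormedAddCommGroup f hf D hD)
    refine this.congr fun t => ?_
    exact integral_map_process_apply hP hC hs₀c t hf.measurable
  have hconv : ∀ f, PlaneLipschitz θ f → ∀ s ∈ configurations,
      Tendsto (fun t : ℝ≥0 => expect P f t s) atTop
        (nhds (∫ x, f x ∂(π : Measure State))) := by
    intro f hf s hs
    have h1 := htest f hf.continuous hf.bounded
    set B := max B₀ (wnorm θ s.2)
    obtain ⟨D, L, hT⟩ := hf.testFunction B
    have hsB : s ∈ region θ B := mem_region_self hs (le_max_right _ _)
    have hs₀B : s₀ ∈ region θ B := ⟨hs₀.1, hs₀.2.trans (le_max_left _ _)⟩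
    rw [Metric.tendsto_nhds]
    intro ε hε
    obtain ⟨t₀, -, ht₀⟩ := expect_asymptotically_constant hP hC (le_max_left _ _ : B₀ ≤ B) hT
      (half_pos hε)
    filter_upwards [eventually_ge_atTop t₀.toNNReal] with t ht
    have h2 : ∀ᶠ t' : ℝ≥0 in 𝒰, |expect P f t s - expect P f t' s₀| ≤ ε / 2 := by
      filter_upwards [h𝒰 (eventually_ge_atTop t₀.toNNReal)] with t' ht'
      exact ht₀ t (Real.toNNReal_le_iff_le_coe.1 ht) t' (Real.toNNReal_le_iff_le_coe.1 ht')
        s hsB s₀ hs₀B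
    have h3 := le_of_tendsto ((h1.const_sub (expect P f t s)).abs) h2
    rw [Real.dist_eq]
    linarith
  refine ⟨π, ?_, hconv, ?_⟩
  -- The negative part of a coordinate, cut off at 1, is bounded and continuous and vanishes along
  -- the process; so its integral under the limit is 0.
  · have hcoord : ∀ k : Fin 2, ∀ᵐ s ∂(π : Measure State), 0 ≤ s.2 k := by
      intro k
      set g : State → ℝ := fun s => min 1 (max (-(s.2 k)) 0)
      have hg : Continuous g := by
        have : Continuous fun s : State => s.2 k := (continuous_apply k).comp continuous_snd
        exact continuous_const.min (this.neg.max continuous_const)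
      have hg0 : ∀ s, 0 ≤ g s := fun s => le_min zero_le_one (le_max_right _ _)
      have hg1 : ∀ s, |g s| ≤ 1 := fun s => by
        rw [abs_of_nonneg (hg0 s)]; exact min_le_left _ _
      have hzero : ∀ t : ℝ≥0, expect P g t s₀ = 0 := fun t => by
        have hgr : ∀ s ∈ region θ B₀, g s = 0 := fun s hs => by
          simp only [g]
          rw [max_eq_right (neg_nonpos.2 (hs.1 k)), min_eq_right zero_le_one]
        exact le_antisymm
          (expect_le hP hC le_rfl hg.measurable hg1 (fun s hs => (hgr s hs).le) _ hs₀)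
          (le_expect hP hC le_rfl hg.measurable hg1 (fun s hs => (hgr s hs).ge) _ hs₀)
      have hint : ∫ s, g s ∂(π : Measure State) = 0 := by
        have h1 := htest g hg ⟨1, hg1⟩
        simp only [hzero] at h1
        exact (tendsto_nhds_unique h1 tendsto_const_nhds)
      have := (integral_eq_zero_iff_of_nonneg hg0 (integrable_of_abs_le hg.measurable hg1)).1 hint
      filter_upwards [this] with s hs
      by_contra hneg
      have h1 : 0 < g s := lt_min one_pos (lt_max_of_lt_left (neg_pos.2 (not_le.1 hneg)))
      exact h1.ne' hs
    filter_upwards [hcoord 0, hcoord 1] with s h0 h1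
    exact ⟨h0, h1⟩
  · intro f hf h
    obtain ⟨D, hD⟩ := hf.bounded
    -- The expectation at time t + h has two limits along the ultrafilter: as the Feller-continuous
    -- function `expect P f h` evaluated at time t, and as f itself at a later time.
    have h1 := htest _ (continuous_expect hP hC hf (NNReal.coe_nonneg h)) ⟨D, abs_expect_le P hD h⟩
    have h2 : Tendsto (fun t : ℝ≥0 => expect P f ((t + h : ℝ≥0) : ℝ) s₀) 𝒰
        (nhds (∫ x, f x ∂(π : Measure State))) :=
      ((hconv f hf s₀ hs₀c).comp (tendsto_atTop_mono (fun _ => le_self_add)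
      tendsto_id)).mono_left h𝒰
    refine tendsto_nhds_unique (h1.congr fun t => ?_) h2
    rw [NNReal.coe_add, expect_add hP hC hf.continuous.measurable hD (NNReal.coe_nonneg t)
      (NNReal.coe_nonneg h) hs₀c]

/-- A constant sequence converges to both laws, and weak limits are unique. -/
theorem eq_of_forall_planeLipschitz {θ : ℝ} (hθ : 0 ≤ θ) {μ μ' : ProbabilityMeasure State}
    (h : ∀ f, PlaneLipschitz θ f →
      ∫ x, f x ∂(μ : Measure State) = ∫ x, f x ∂(μ' : Measure State)) : μ = μ' := by
  have : Tendsto (fun _ : ℕ => μ) atTop (nhds μ') :=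
    tendsto_of_forall_planeLipschitz hθ fun f hf => by
      rw [h f hf]; exact tendsto_const_nhds
  exact tendsto_nhds_unique tendsto_const_nhds this

/-- Pointwise convergence with the common bound D is enough: no uniformity over the unbounded set of
configurations is needed. -/
theorem tendsto_integral_expect {P : TwoPlaneParams} (hP : Positive P) {θ c M : ℝ}
    (hC : Contracts P θ c M) {μ : ProbabilityMeasure State} (hμ : IsInitialLaw μ)
    {f : State → ℝ} (hf : Measurable f) {D : ℝ} (hD : ∀ x, |f x| ≤ D) {a : ℝ}
    (h : ∀ s ∈ configurations, Tendsto (fun t : ℝ≥0 => expect P f t s) atTop (nhds a)) :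
    Tendsto (fun t : ℝ≥0 => ∫ s, expect P f t s ∂(μ : Measure State)) atTop (nhds a) := by
  have := tendsto_integral_filter_of_dominated_convergence (μ := (μ : Measure State))
    (l := (atTop : Filter ℝ≥0)) (F := fun t s => expect P f t s) (f := fun _ => a)
    (bound := fun _ => D)
    (Eventually.of_forall fun t => (measurable_expect_snd hP hC hf t).aestronglyMeasurable)
    (Eventually.of_forall fun t => ae_of_all _ fun s => abs_expect_le P hD t s)
    (integrable_const D) (by filter_upwards [hμ] with s hs using h s hs)
  simpa using this

end TwoPlane

end

theorem theorem7 (P : TwoPlaneParams) (hν : 0 < P.ν) (hp : P.p ∈ Set.Ioo (0 : ℝ) 1)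
    (hα : 0 < P.α) (hβ : 0 < P.β) (hδ : 0 < P.δ) (hε : 0 < P.ε) (hη : 0 < P.η) :
    ∃ π : ProbabilityMeasure TwoPlane.State,
      TwoPlane.IsInitialLaw π ∧ TwoPlane.IsStationary P π ∧
      (∀ π' : ProbabilityMeasure TwoPlane.State,
        TwoPlane.IsInitialLaw π' → TwoPlane.IsStationary P π' → π' = π) ∧
      (∀ s ∈ TwoPlane.configurations,
        TendstoInDistribution (fun (t : ℝ≥0) (ω : ℕ → ℝ) => TwoPlane.process P t s ω) atTop
          (id : TwoPlane.State → TwoPlane.State) (fun _ => TwoPlane.clocks)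
          (π : Measure TwoPlane.State)) ∧
      (∀ μ : ProbabilityMeasure TwoPlane.State, TwoPlane.IsInitialLaw μ →
        TendstoInDistribution
          (fun (t : ℝ≥0) (x : TwoPlane.State × (ℕ → ℝ)) => TwoPlane.process P t x.1 x.2) atTop
          (id : TwoPlane.State → TwoPlane.State)
          (fun _ => (μ : Measure TwoPlane.State).prod TwoPlane.clocks)
          (π : Measure TwoPlane.State)) := by
  have hP : TwoPlane.Positive P := ⟨hν, hp.1, hp.2, hα, hβ, hδ, hε, hη⟩
  obtain ⟨θ, c, M, hC⟩ := TwoPlane.exists_contracts hP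
  have hθ := hC.θ_nonneg
  obtain ⟨π, hπ, hconv, hstat⟩ := TwoPlane.exists_limit_law hP hC
  have hid : ∀ h : IsProbabilityMeasure ((π : Measure TwoPlane.State).map id),
      (⟨(π : Measure TwoPlane.State).map id, h⟩ : ProbabilityMeasure TwoPlane.State) = π :=
    fun h => Subtype.ext Measure.map_id
  refine ⟨π, hπ, ?_, ?_, ?_, ?_⟩
  · intro t
    have hm := TwoPlane.aemeasurable_process hP hC hπ t
    have := TwoPlane.eq_of_forall_planeLipschitz hθ
      (μ := ⟨_, Measure.isProbabilityMeasure_map hm⟩) (μ' := π) fun f hf => by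
        obtain ⟨D, hD⟩ := hf.bounded
        exact (TwoPlane.integral_map_process hP hC hπ t hf.continuous.measurable hD).trans
          (hstat f hf t)
    exact congrArg Subtype.val this
  · intro π' hπ' hstat'
    refine TwoPlane.eq_of_forall_planeLipschitz hθ fun f hf => ?_
    obtain ⟨D, hD⟩ := hf.bounded
    have h1 := TwoPlane.tendsto_integral_expect hP hC hπ' hf.continuous.measurable hD
      (hconv f hf)
    -- Under a stationary law the mean of f is constant in time, yet it converges to its mean under
    -- π.
    refine tendsto_nhds_unique (tendsto_const_nhds.congr fun t => ?_) h1
    rw [← TwoPlane.integral_map_process hP hC hπ' t hf.continuous.measurable hD, hstat' t]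
  · intro s hs
    refine ⟨fun t => (TwoPlane.measurable_process_apply hP hC hs t).aemeasurable,
      aemeasurable_id, ?_⟩
    rw [hid]
    refine TwoPlane.tendsto_of_forall_planeLipschitz hθ fun f hf => ?_
    refine (hconv f hf s hs).congr fun t => ?_
    exact (TwoPlane.integral_map_process_apply hP hC hs t hf.continuous.measurable).symm
  · intro μ hμ
    refine ⟨fun t => TwoPlane.aemeasurable_process hP hC hμ t, aemeasurable_id, ?_⟩
    rw [hid]
    refine TwoPlane.tendsto_of_forall_planeLipschitz hθ fun f hf => ?_
    obtain ⟨D, hD⟩ := hf.bounded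
    refine (TwoPlane.tendsto_integral_expect hP hC hμ hf.continuous.measurable hD
      (hconv f hf)).congr fun t => ?_
    exact (TwoPlane.integral_map_process hP hC hμ t hf.continuous.measurable hD).symm
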